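/- Let $\widetilde J(x_1,\dots,x_{n+1},y_1,\dots,y_{n+1})=(y_1,\dots,y_{n+1},x_1,\dots,x_{n+1})$ be the standard para-complex structure on $\mathbb R^{2n+2}$, and let $\mathrm D$ be the flat connection. All objects are smooth and hypersurfaces are immersed. *Definitions (real case).* Let $M$ be a connected $(2n+1)$-dimensional manifold, $f\colon M\to\mathbb R^{2n+2}$ an immersion and $C$ a transversal vector field along $f$. Write $\mathrm D_Xf_*Y=f_*(\nabla_XY)+h(X,Y)C$, $\mathrm D_XC=-f_*(SX)+\tau(X)C$ and $\Theta(X_1,\dots,X_{2n+1})=\det[f_*X_1,\dots,f_*X_{2n+1},C]$. If $h$ is nondegenerate, $\omega_h$ denotes its metric volume form, $\omega_h(X_1,\dots,X_{2n+1})=|\det[h(X_i,X_j)]|^{1/2}$ on bases positively oriented relative to $\Theta$. The field $C$ is a Blaschke (affine normal) field if $h$ is nondegenerate, $\omega_h$ is $\nabla$-parallel and $\omega_h=\Theta$. The hypersurface $f$ is a $\widetilde J$-tangent affine hypersphere if it has a Blaschke field $C$ with $S=\lambda I$ for a constant $\lambda\in\mathbb R$ and $\widetilde JC_x\in f_*(T_xM)$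 for all $x\in M$. Let $\mathcal D_x=f_*^{-1}\bigl(f_*(T_xM)\cap\widetilde J f_*(T_xM)\bigr)$. *Definitions (para-complex case).* Let $N$ be a connected $2n$-dimensional manifold and $g\colon N\to\mathbb R^{2n+2}$ an immersion such that every $g_*(T_xN)$ is $\widetilde J$-invariant and the eigenspaces of $\widetilde J|_{g_*(T_xN)}$ for the eigenvalues $1$ and $-1$ have equal dimension. For a vector field $\zeta$ along $g$ such that $\{\zeta,\widetilde J\zeta\}$ spans a transversal bundle, write $\mathrm D_Xg_*Y=g_*(\nabla_XY)+h_1(X,Y)\zeta+h_2(X,Y)\widetilde J\zeta$ and $\mathrm D_X\zeta=-g_*(SX)+\tau_1(X)\zeta+\tau_2(X)\widetilde J\zeta$. The field $\zeta$ is an affine normal vector field if $h_1$ is nondegenerate, $\tau_1=0$ and $|\det[h_1(X_i,X_j)]|=1$ for all tangent vectors $X_1,\dots,X_{2n}$ at a point with $\det(g_*X_1,\dots,g_*X_{2n},\zeta,\widetilde J\zeta)=1$. The immersion $g$ is a proper para-complex affine hypersphere with centre at the origin if it has an affine normal vector field $\zeta$ with $S=\alpha I$ for a constant $\alpha\in\mathbb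 R\setminus\{0\}$, $\tau_2=0$ and $\zeta=-\alpha g$. **Theorem.** (1) Let $f\colon M\to\mathbb R^{2n+2}$ be a $\widetilde J$-tangent affine hypersphere, with $\widetilde J$-tangent Blaschke field $C$, whose distribution $\mathcal D$ is involutive. Then there are $\lambda\neq0$ and a point $c\in\mathbb R^{2n+2}$ (the centre of $f$) such that $C=-\lambda(f-c)$, and around every point of $M$ there are local coordinates $(x_1,\dots,x_{2n},z)$, ranging over $V\times I$ with $V\subset\mathbb R^{2n}$ open and connected and $I\subset\mathbb R$ an open interval, in which $$f(x_1,\dots,x_{2n},z)=c+\widetilde Jg(x_1,\dots,x_{2n})\cosh z-g(x_1,\dots,x_{2n})\sinh z$$ for some proper para-complex affine hypersphere $g\colon V\to\mathbb R^{2n+2}$ with centre at the origin. In particular, if the centre of $f$ is the origin, then locally $f=\widetilde Jg\cosh z-g\sinh z$. (2) Conversely, if $g\colon N\to\mathbb R^{2n+2}$ is a proper para-complex affine hypersphere with centre at the origin, then $f\colon N\times\mathbb R\to\mathbb R^{2n+2}$, $f(x,z)=\widetilde Jg(x)\cosh z-g(x)\sinh z$, is a $\widetilde J$-tangent affine hypersphere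 whose distribution $\mathcal D$ is involutive. -/

import Mathlib

open scoped Manifold ContDiff

namespace ParaAffine

noncomputable section

/-! ### Real affine hypersurfaces, in a chart

`F : E → ℝ^{m+1}` is a map defined on an open subset `U` of an `m`-dimensional normed space `E`
(the image of a chart) and `C` is a vector field along `F`.  Tangent vectors are elements of `E`,
and they are also regarded as constant (coordinate) vector fields. -/

section Hypersurface

variable {E : Type*} [NormedAddCommGroup E] [NormedSpace ℝ E] {m : ℕ}

/-- The map `T_x U ⊕ ℝ → ℝ^{m+1}`, `(u, t) ↦ F_* u + t C`. -/
def frame (F C : E → Fin (m + 1) → ℝ) (x : E) : E × ℝ →ₗ[ℝ] (Fin (m + 1) → ℝ) :=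
  (fderiv ℝ F x : E →ₗ[ℝ] (Fin (m + 1) → ℝ)).coprod (LinearMap.toSpanSingleton ℝ _ (C x))

/-- The `T_x U`-component of `w` in the decomposition `w = F_* u + t C`. -/
def tanPart (F C : E → Fin (m + 1) → ℝ) (x : E) (w : Fin (m + 1) → ℝ) : E :=
  (Function.invFun (frame F C x) w).1

/-- The coefficient of `C` in the decomposition `w = F_* u + t C`. -/
def transPart (F C : E → Fin (m + 1) → ℝ) (x : E) (w : Fin (m + 1) → ℝ) : ℝ :=
  (Function.invFun (frame F C x) w).2

/-- The induced connection `∇_u v` on constant fields `u, v` (formula of Gauss,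
`D_u F_* v = F_* (∇_u v) + h(u, v) C`). -/
def nablaConst (F C : E → Fin (m + 1) → ℝ) (x u v : E) : E :=
  tanPart F C x (fderiv ℝ (fderiv ℝ F) x u v)

/-- The second fundamental form `h` (formula of Gauss). -/
def secondForm (F C : E → Fin (m + 1) → ℝ) (x u v : E) : ℝ :=
  transPart F C x (fderiv ℝ (fderiv ℝ F) x u v)

/-- The shape operator `S` (formula of Weingarten, `D_u C = - F_* (S u) + τ(u) C`). -/
def shapeOp (F C : E → Fin (m + 1) → ℝ) (x u : E) : E :=
  - tanPart F C x (fderiv ℝ C x u)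

/-- The induced volume element `Θ(X_1, …, X_m) = det [F_* X_1, …, F_* X_m, C]`. -/
def inducedVol (F C : E → Fin (m + 1) → ℝ) (x : E) (X : Fin m → E) : ℝ :=
  Matrix.det (Matrix.of
    (Fin.snoc (α := fun _ => Fin (m + 1) → ℝ) (fun i => fderiv ℝ F x (X i)) (C x)))

/-- The metric volume form `ω_h` of `h`: it equals `|det [h(X_i, X_j)]|^{1/2}` on bases that are
positively oriented relative to `Θ`, and is extended as an alternating form. -/
def metricVol (F C : E → Fin (m + 1) → ℝ) (x : E) (X : Fin m → E) : ℝ :=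
  Real.sign (inducedVol F C x X) *
    √ |Matrix.det (Matrix.of fun i j => secondForm F C x (X i) (X j))|

/-- `F` is a nondegenerate immersed hypersurface on `U` and `C` is its affine normal
(Blaschke) field. -/
structure IsBlaschkeOn (F C : E → Fin (m + 1) → ℝ) (U : Set E) : Prop where
  smooth : ContDiffOn ℝ ∞ F U
  smooth_field : ContDiffOn ℝ ∞ C U
  immersion : ∀ x ∈ U, Function.Injective (fderiv ℝ F x)
  transversal : ∀ x ∈ U, Function.Bijective (frame F C x)
  nondegenerate : ∀ x ∈ U, ∀ u, (∀ v, secondForm F C x u v = 0) → u = 0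
  parallel : ∀ x ∈ U, ∀ (u : E) (X : Fin m → E),
    fderiv ℝ (fun y => metricVol F C y X) x u =
      ∑ i, metricVol F C x (Function.update X i (nablaConst F C x u (X i)))
  volume : ∀ x ∈ U, ∀ X : Fin m → E, metricVol F C x X = inducedVol F C x X

/-- `F` with the Blaschke field `C` is an affine hypersphere on `U` with `S = lam • I`. -/
structure IsAffineHypersphereOn (F C : E → Fin (m + 1) → ℝ) (lam : ℝ) (U : Set E) : Prop where
  blaschke : IsBlaschkeOn F C U
  shape : ∀ x ∈ U, ∀ u, shapeOp F C x u = lam • u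

end Hypersurface

/-! ### The para-complex structure -/

/-- The space `ℝ^{2n+2}`. -/
abbrev RSpace (n : ℕ) : Type := Fin (2 * n + 1 + 1) → ℝ

/-- The standard para-complex structure
`(x_1, …, x_{n+1}, y_1, …, y_{n+1}) ↦ (y_1, …, y_{n+1}, x_1, …, x_{n+1})`: the `i`-th coordinate
of the image is the coordinate with index `i + (n + 1)` modulo `2n + 2`. -/
def Jt (n : ℕ) : RSpace n →ₗ[ℝ] RSpace n :=
  LinearMap.funLeft ℝ ℝ fun i => i + ⟨n + 1, by omega⟩

section ParaComplex

variable {E : Type*} [NormedAddCommGroup E] [NormedSpace ℝ E]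

/-- The tangent space `F_* (T_x U)`. -/
def tangent {n : ℕ} (F : E → RSpace n) (x : E) : Submodule ℝ (RSpace n) :=
  LinearMap.range (fderiv ℝ F x : E →ₗ[ℝ] RSpace n)

/-- The distribution `𝒟_x = F_*⁻¹ (F_* T_x U ∩ J F_* T_x U)`. -/
def distr {n : ℕ} (F : E → RSpace n) (x : E) : Submodule ℝ E :=
  (tangent F x ⊓ (tangent F x).map (Jt n)).comap (fderiv ℝ F x : E →ₗ[ℝ] RSpace n)

/-- The distribution `𝒟` of `F` is involutive on `U`. -/
def IsInvolutiveOn {n : ℕ} (F : E → RSpace n) (U : Set E) : Prop :=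
  ∀ X Y : E → E, ContDiffOn ℝ ∞ X U → ContDiffOn ℝ ∞ Y U →
    (∀ x ∈ U, X x ∈ distr F x) → (∀ x ∈ U, Y x ∈ distr F x) →
    ∀ x ∈ U, VectorField.lieBracket ℝ X Y x ∈ distr F x

/-- A field `C` along `F` is `J`-tangent on `U`. -/
def IsJTangentOn {n : ℕ} (F C : E → RSpace n) (U : Set E) : Prop :=
  ∀ x ∈ U, Jt n (C x) ∈ tangent F x

/-- A `J`-invariant subspace of `ℝ^{2n+2}` on which `J` is a para-complex structure, that is
the eigenspaces of the eigenvalues `1` and `-1` have equal dimension. -/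
def IsParaComplexSubspace {n : ℕ} (T : Submodule ℝ (RSpace n)) : Prop :=
  (∀ w ∈ T, Jt n w ∈ T) ∧
    Module.finrank ℝ (T ⊓ Module.End.eigenspace (Jt n) 1 : Submodule ℝ (RSpace n)) =
      Module.finrank ℝ (T ⊓ Module.End.eigenspace (Jt n) (-1) : Submodule ℝ (RSpace n))

/-- The map `T_x U ⊕ ℝ ⊕ ℝ → ℝ^{2n+2}`, `(u, s, t) ↦ g_* u + s ζ + t Jζ`. -/
def pframe {n : ℕ} (g ζ : E → RSpace n) (x : E) : E × ℝ × ℝ →ₗ[ℝ] RSpace n :=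
  (fderiv ℝ g x : E →ₗ[ℝ] RSpace n).coprod
    ((LinearMap.toSpanSingleton ℝ _ (ζ x)).coprod (LinearMap.toSpanSingleton ℝ _ (Jt n (ζ x))))

/-- The components `(u, s, t)` of `w = g_* u + s ζ + t Jζ`. -/
def pparts {n : ℕ} (g ζ : E → RSpace n) (x : E) (w : RSpace n) : E × ℝ × ℝ :=
  Function.invFun (pframe g ζ x) w

/-- The form `h_1` in `D_u g_* v = g_* (∇_u v) + h_1(u, v) ζ + h_2(u, v) Jζ`. -/
def pform1 {n : ℕ} (g ζ : E → RSpace n) (x u v : E) : ℝ :=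
  (pparts g ζ x (fderiv ℝ (fderiv ℝ g) x u v)).2.1

/-- The operator `S` in `D_u ζ = - g_* (S u) + τ_1(u) ζ + τ_2(u) Jζ`. -/
def pshape {n : ℕ} (g ζ : E → RSpace n) (x u : E) : E :=
  - (pparts g ζ x (fderiv ℝ ζ x u)).1

/-- The form `τ_1` in `D_u ζ = - g_* (S u) + τ_1(u) ζ + τ_2(u) Jζ`. -/
def ptau1 {n : ℕ} (g ζ : E → RSpace n) (x u : E) : ℝ :=
  (pparts g ζ x (fderiv ℝ ζ x u)).2.1

/-- The form `τ_2` in `D_u ζ = - g_* (S u) + τ_1(u) ζ + τ_2(u) Jζ`. -/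
def ptau2 {n : ℕ} (g ζ : E → RSpace n) (x u : E) : ℝ :=
  (pparts g ζ x (fderiv ℝ ζ x u)).2.2

/-- `θ_ζ(X_1, …, X_{2n}) = det (g_* X_1, …, g_* X_{2n}, ζ, Jζ)`. -/
def pvol {n : ℕ} (g ζ : E → RSpace n) (x : E) (X : Fin (2 * n) → E) : ℝ :=
  Matrix.det (Matrix.of
    (Fin.snoc (α := fun _ => RSpace n)
      (Fin.snoc (α := fun _ => RSpace n) (fun i => fderiv ℝ g x (X i)) (ζ x)) (Jt n (ζ x))))

/-- `g` is a nondegenerate para-complex affine hypersurface on `U` with transversal bundle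
`{ζ, Jζ}`, and `ζ` is an affine normal vector field: `|H_ζ| = 1` and `τ_1 = 0`. -/
structure IsParaAffineNormalOn {n : ℕ} (g ζ : E → RSpace n) (U : Set E) : Prop where
  smooth : ContDiffOn ℝ ∞ g U
  smooth_field : ContDiffOn ℝ ∞ ζ U
  immersion : ∀ x ∈ U, Function.Injective (fderiv ℝ g x)
  paraComplex : ∀ x ∈ U, IsParaComplexSubspace (tangent g x)
  transversal : ∀ x ∈ U, Function.Bijective (pframe g ζ x)
  nondegenerate : ∀ x ∈ U, ∀ u, (∀ v, pform1 g ζ x u v = 0) → u = 0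
  normalized : ∀ x ∈ U, ∀ X : Fin (2 * n) → E, pvol g ζ x X = 1 →
    |Matrix.det (Matrix.of fun i j => pform1 g ζ x (X i) (X j))| = 1
  tau1 : ∀ x ∈ U, ∀ u, ptau1 g ζ x u = 0

/-- `g` is a para-complex affine hypersphere on `U`, with affine normal vector field `ζ` such
that `S = a • I` and `τ_2 = 0`. -/
structure IsParaHypersphereOn {n : ℕ} (g ζ : E → RSpace n) (a : ℝ) (U : Set E) : Prop where
  normal : IsParaAffineNormalOn g ζ U
  shape : ∀ x ∈ U, ∀ u, pshape g ζ x u = a • u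
  tau2 : ∀ x ∈ U, ∀ u, ptau2 g ζ x u = 0

/-- `g` is a proper para-complex affine hypersphere on `U`, with centre at the origin. -/
def IsCenteredProperParaHypersphereOn {n : ℕ} (g : E → RSpace n) (U : Set E) : Prop :=
  ∃ (a : ℝ) (ζ : E → RSpace n), a ≠ 0 ∧ IsParaHypersphereOn g ζ a U ∧
    ∀ x ∈ U, ζ x = - (a • g x)

end ParaComplex

/-! ### The same notions on a manifold without boundary

All the notions above are tensorial and local, so they are imposed in the charts that cover the
manifold; the constants `lam`, `a` and the fields `C`, `ζ` are global. -/

section Manifold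

variable {E : Type*} [NormedAddCommGroup E] [NormedSpace ℝ E] {H : Type*} [TopologicalSpace H]
  (I : ModelWithCorners ℝ E H) {M : Type*} [TopologicalSpace M] [ChartedSpace H M] {n : ℕ}

/-- `f : M → ℝ^{2n+2}` is an affine hypersphere with Blaschke field `C`, which is
`J`-tangent. -/
def IsJTangentAffineHypersphere (f C : M → RSpace n) : Prop :=
  ∃ lam : ℝ, ∀ p : M,
    IsAffineHypersphereOn (f ∘ (extChartAt I p).symm) (C ∘ (extChartAt I p).symm) lam
      (extChartAt I p).target ∧
    IsJTangentOn (f ∘ (extChartAt I p).symm) (C ∘ (extChartAt I p).symm) (extChartAt I p).target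

/-- The distribution `𝒟` of `f : M → ℝ^{2n+2}` is involutive. -/
def HasInvolutiveDistribution (f : M → RSpace n) : Prop :=
  ∀ p : M, IsInvolutiveOn (f ∘ (extChartAt I p).symm) (extChartAt I p).target

/-- `g : M → ℝ^{2n+2}` is a proper para-complex affine hypersphere with centre at the origin. -/
def IsCenteredProperParaHypersphere (g : M → RSpace n) : Prop :=
  ∃ (a : ℝ) (ζ : M → RSpace n), a ≠ 0 ∧
    (∀ p : M, IsParaHypersphereOn (g ∘ (extChartAt I p).symm) (ζ ∘ (extChartAt I p).symm) a
      (extChartAt I p).target) ∧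
    ∀ p, ζ p = - (a • g p)

end Manifold

/-- The map `(x, z) ↦ J g(x) cosh z - g(x) sinh z`. -/
def hyperMap {A : Type*} {n : ℕ} (g : A → RSpace n) (q : A × ℝ) : RSpace n :=
  Real.cosh q.2 • Jt n (g q.1) - Real.sinh q.2 • g q.1

end

end ParaAffine

namespace ParaAffine

noncomputable section

/-! Put R_z = cosh z J - sinh z, so that the hypersurface is f = R_z g. Since J² = 1, R_z commutes
with J, has inverse R_{-z}, satisfies |det R_z| = 1, and d/dz R_z = -R_z J. Hence f_z = -Jf and f_zz
= f.

Both directions rest on one pointwise comparison (`IsHyperAt`). With C = -λf and ζ = -ag, R_z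
carries the frame (g_*, ζ, Jζ) to (f_*, C) up to constants and order. In the frame (X_i, ∂_z) the
form h is the block sum of (a/λ)h_1 and -1/λ (`secondForm_eq`), and |Θ| = |λ|/a² |θ_ζ|
(`abs_inducedVol_eq`). So |det h| = Θ² amounts to |a|^{2n+4} |det h_1| = |λ|^{2n+3} θ_ζ². The
normalization of g thus matches that of f once |λ|^{2n+3} = |a|^{2n+4}, and either constant can be
solved for in terms of the other. This settles (2), because 𝒟 is then the kernel of dz.

For (1), ω_h = Θ together with ∇ω_h = 0 forces τ = 0 (`fderiv_inducedVol`), so C + λf is locally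
constant. The case λ = 0 contradicts nondegeneracy (`lam_ne_zero`), and so a centre c exists; move
it to the origin. Let ν be the conormal with ν(f_*) = 0 and ν(f) = 1, let f_*Z = -Jf, and let η =
-ν∘J∘f_*. Then ker η = 𝒟 and η(Z) = 1. Always dη(Z, ·) = 0, and involutivity kills dη on 𝒟, so η is
closed (`fderiv_etaForm_symm`). Locally η = dζ, and G = R_{-ζ} f has differential with kernel
spanned by Z. Completing ζ to coordinates by functions of G gives f = R_z g, and the comparison
shows that g is a para-complex hypersphere. -/

/-! ### Para-complex linear algebra and the rotations R_z -/

theorem Jt_apply {n : ℕ} (w : RSpace n) (i : Fin (2 * n + 1 + 1)) :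
    Jt n w i = w (i + ⟨n + 1, by omega⟩) := rfl

theorem Jt_Jt {n : ℕ} (w : RSpace n) : Jt n (Jt n w) = w := by
  funext i
  rw [Jt_apply, Jt_apply, add_assoc]
  congr 1
  have h : (⟨n + 1, by omega⟩ + ⟨n + 1, by omega⟩ : Fin (2 * n + 1 + 1)) = 0 := by
    apply Fin.ext
    simp only [Fin.val_add, Fin.val_zero]
    rw [show n + 1 + (n + 1) = 2 * n + 1 + 1 by omega, Nat.mod_self]
  rw [h, add_zero]

/-- The para-complex structure as a continuous linear map. -/
def JtL (n : ℕ) : RSpace n →L[ℝ] RSpace n := LinearMap.toContinuousLinearMap (Jt n)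

@[simp] theorem JtL_apply {n : ℕ} (w : RSpace n) : JtL n w = Jt n w := rfl

/-- The para-complex rotation `cosh z • J - sinh z • 1`. -/
def hyperRot (n : ℕ) (z : ℝ) : RSpace n →L[ℝ] RSpace n :=
  Real.cosh z • JtL n - Real.sinh z • ContinuousLinearMap.id ℝ _

theorem hyperRot_apply {n : ℕ} (z : ℝ) (w : RSpace n) :
    hyperRot n z w = Real.cosh z • Jt n w - Real.sinh z • w := rfl

theorem hyperMap_eq {A : Type*} {n : ℕ} (g : A → RSpace n) (q : A × ℝ) :
    hyperMap g q = hyperRot n q.2 (g q.1) := rfl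

theorem hyperRot_neg_hyperRot {n : ℕ} (z : ℝ) (w : RSpace n) :
    hyperRot n (-z) (hyperRot n z w) = w := by
  simp only [hyperRot_apply, map_sub, map_smul, Jt_Jt, Real.cosh_neg, Real.sinh_neg]
  have h := Real.cosh_sq z
  ext i
  simp only [Pi.sub_apply, Pi.smul_apply, smul_eq_mul]
  linear_combination w i * h

theorem hyperRot_hyperRot_neg {n : ℕ} (z : ℝ) (w : RSpace n) :
    hyperRot n z (hyperRot n (-z) w) = w := by
  simpa using hyperRot_neg_hyperRot (-z) w

theorem Jt_hyperRot {n : ℕ} (z : ℝ) (w : RSpace n) :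
    Jt n (hyperRot n z w) = hyperRot n z (Jt n w) := by
  simp only [hyperRot_apply, map_sub, map_smul]

theorem hyperRot_bijective (n : ℕ) (z : ℝ) : Function.Bijective (hyperRot n z) :=
  Function.bijective_iff_has_inverse.2
    ⟨hyperRot n (-z), hyperRot_neg_hyperRot z, hyperRot_hyperRot_neg z⟩

/-- The reflection changing the sign of the last `n + 1` coordinates. -/
def conjRefl (n : ℕ) : RSpace n →ₗ[ℝ] RSpace n :=
  LinearMap.pi fun i => (if i.val < n + 1 then (1 : ℝ) else -1) • LinearMap.proj i

theorem conjRefl_apply {n : ℕ} (w : RSpace n) (i : Fin (2 * n + 1 + 1)) :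
    conjRefl n w i = (if i.val < n + 1 then (1 : ℝ) else -1) * w i := rfl

theorem conjRefl_conjRefl {n : ℕ} (w : RSpace n) : conjRefl n (conjRefl n w) = w := by
  funext i
  rw [conjRefl_apply, conjRefl_apply]
  split_ifs <;> ring

theorem conjRefl_Jt {n : ℕ} (w : RSpace n) : conjRefl n (Jt n w) = - Jt n (conjRefl n w) := by
  funext i
  rw [Pi.neg_apply, conjRefl_apply, Jt_apply, Jt_apply, conjRefl_apply]
  have hi := i.isLt
  have h : (i + ⟨n + 1, by omega⟩ : Fin (2 * n + 1 + 1)).val < n + 1 ↔ ¬ i.val < n + 1 := by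
    simp only [Fin.val_add]
    by_cases hlt : i.val < n + 1
    · rw [Nat.mod_eq_of_lt (by omega)]; omega
    · rw [Nat.mod_eq_sub_mod (by omega), Nat.mod_eq_of_lt (by omega)]; omega
  by_cases hlt : i.val < n + 1
  · rw [if_pos hlt, if_neg (by rw [h]; exact not_not.2 hlt)]; ring
  · rw [if_neg hlt, if_pos (h.2 hlt)]; ring

/-- The reflection K anticommutes with J, so K R_z = -R_{-z} K. In even dimension this gives det R_z
= det R_{-z}, while the product of the two determinants is 1. -/
theorem abs_det_hyperRot (n : ℕ) (z : ℝ) :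
    |LinearMap.det (hyperRot n z : RSpace n →ₗ[ℝ] RSpace n)| = 1 := by
  set R : ℝ → (RSpace n →ₗ[ℝ] RSpace n) := fun z => (hyperRot n z : RSpace n →ₗ[ℝ] RSpace n)
    with hR
  have hK : LinearMap.det (conjRefl n) ≠ 0 := by
    have h : conjRefl n ∘ₗ conjRefl n = LinearMap.id := LinearMap.ext conjRefl_conjRefl
    have h2 := congrArg LinearMap.det h
    rw [LinearMap.det_comp, LinearMap.det_id] at h2
    exact left_ne_zero_of_mul_eq_one h2
  have h1 : LinearMap.det (R (-z)) * LinearMap.det (R z) = 1 := by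
    rw [← LinearMap.det_comp, show R (-z) ∘ₗ R z = LinearMap.id from
      LinearMap.ext (hyperRot_neg_hyperRot z), LinearMap.det_id]
  have h2 : conjRefl n ∘ₗ R z = ((-1 : ℝ) • R (-z)) ∘ₗ conjRefl n := by
    refine LinearMap.ext fun w => ?_
    change conjRefl n (hyperRot n z w) = (-1 : ℝ) • hyperRot n (-z) (conjRefl n w)
    simp only [hyperRot_apply, map_sub, map_smul, conjRefl_Jt, Real.cosh_neg, Real.sinh_neg]
    module
  have h3 : LinearMap.det (R z) = (-1) ^ (2 * n + 1 + 1) * LinearMap.det (R (-z)) := by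
    have h := congrArg LinearMap.det h2
    rw [LinearMap.det_comp, LinearMap.det_comp, LinearMap.det_smul, Module.finrank_fin_fun] at h
    exact mul_left_cancel₀ hK (by rw [h]; ring)
  have h4 : |LinearMap.det (R z)| = |LinearMap.det (R (-z))| := by
    rw [h3, abs_mul, abs_pow]; simp
  have h5 := congrArg abs h1
  rw [abs_mul, ← h4, abs_one] at h5
  nlinarith [abs_nonneg (LinearMap.det (R z))]

/-- An eigenvector is determined by its first n + 1 coordinates, since J exchanges the two halves.
-/
theorem finrank_eigenspace_le (n : ℕ) {s : ℝ} (hs : s = 1 ∨ s = -1) :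
    Module.finrank ℝ (Module.End.eigenspace (Jt n) s) ≤ n + 1 := by
  have hs0 : s * s = 1 := by rcases hs with rfl | rfl <;> norm_num
  let L : Module.End.eigenspace (Jt n) s →ₗ[ℝ] (Fin (n + 1) → ℝ) :=
    (LinearMap.funLeft ℝ ℝ fun i : Fin (n + 1) => (⟨i.val, by omega⟩ : Fin (2 * n + 1 + 1))) ∘ₗ
      (Module.End.eigenspace (Jt n) s).subtype
  have hL : Function.Injective L := by
    rw [← LinearMap.ker_eq_bot, LinearMap.ker_eq_bot']
    rintro ⟨w, hw⟩ h
    rw [Module.End.mem_eigenspace_iff] at hw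
    have hlow : ∀ i : Fin (2 * n + 1 + 1), i.val < n + 1 → w i = 0 := fun i hi =>
      congrFun h ⟨i.val, hi⟩
    apply Subtype.ext
    funext i
    change w i = 0
    by_cases hi : i.val < n + 1
    · exact hlow i hi
    · have h1 := congrFun hw i
      rw [Jt_apply, Pi.smul_apply, smul_eq_mul, hlow] at h1
      · have : s * (s * w i) = 0 := by rw [← h1, mul_zero]
        rwa [← mul_assoc, hs0, one_mul] at this
      · have := i.isLt
        simp only [Fin.val_add]
        rw [Nat.mod_eq_sub_mod (by omega), Nat.mod_eq_of_lt (by omega)]; omega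
  simpa using LinearMap.finrank_le_finrank_of_injective hL

theorem det_of_hyperRot {n : ℕ} (z : ℝ) (v : Fin (2 * n + 1 + 1) → RSpace n) :
    |Matrix.det (Matrix.of fun i => hyperRot n z (v i))| = |Matrix.det (Matrix.of v)| := by
  have h := (Pi.basisFun ℝ (Fin (2 * n + 1 + 1))).det_comp
    (hyperRot n z : RSpace n →ₗ[ℝ] RSpace n) v
  rw [Pi.basisFun_det] at h
  have h2 := congrArg abs h
  rw [abs_mul, abs_det_hyperRot, one_mul] at h2
  exact h2

/-! ### The frame (F_*, C) and the forms it defines -/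

section Frame

variable {E : Type*} [NormedAddCommGroup E] [NormedSpace ℝ E] {m : ℕ}
  {F C : E → Fin (m + 1) → ℝ} {x : E}

theorem frame_apply (F C : E → Fin (m + 1) → ℝ) (x u : E) (t : ℝ) :
    frame F C x (u, t) = fderiv ℝ F x u + t • C x := by
  simp [frame]

theorem pframe_apply {n : ℕ} (g ζ : E → RSpace n) (x u : E) (s t : ℝ) :
    pframe g ζ x (u, s, t) = fderiv ℝ g x u + (s • ζ x + t • Jt n (ζ x)) := by
  simp [pframe]

theorem invFun_frame (h : Function.Bijective (frame F C x)) (p : E × ℝ) :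
    Function.invFun (frame F C x) (frame F C x p) = p :=
  Function.leftInverse_invFun h.1 p

theorem transPart_add_smul (h : Function.Bijective (frame F C x)) (u : E) (t : ℝ) :
    transPart F C x (fderiv ℝ F x u + t • C x) = t := by
  rw [← frame_apply, transPart, invFun_frame h]

theorem tanPart_add_smul (h : Function.Bijective (frame F C x)) (u : E) (t : ℝ) :
    tanPart F C x (fderiv ℝ F x u + t • C x) = u := by
  rw [← frame_apply, tanPart, invFun_frame h]

theorem eq_tanPart_add_transPart (h : Function.Bijective (frame F C x)) (w : Fin (m + 1) → ℝ) :
    w = fderiv ℝ F x (tanPart F C x w) + transPart F C x w • C x := by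
  rw [← frame_apply]
  exact (Function.invFun_eq (h.2 w)).symm

/-- The linear form `transPart`. -/
theorem exists_linear_transPart (h : Function.Bijective (frame F C x)) :
    ∃ ν : (Fin (m + 1) → ℝ) →ₗ[ℝ] ℝ, ∀ w, transPart F C x w = ν w := by
  refine ⟨LinearMap.snd ℝ E ℝ ∘ₗ (LinearEquiv.ofBijective (frame F C x) h).symm.toLinearMap,
    fun w => ?_⟩
  obtain ⟨p, rfl⟩ := h.2 w
  have h2 : (LinearEquiv.ofBijective (frame F C x) h).symm (frame F C x p) = p :=
    (LinearEquiv.ofBijective (frame F C x) h).symm_apply_apply p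
  simp only [LinearMap.comp_apply, LinearEquiv.coe_coe, h2, transPart, invFun_frame h,
    LinearMap.snd_apply]

theorem transPart_fderiv (h : Function.Bijective (frame F C x)) (u : E) :
    transPart F C x (fderiv ℝ F x u) = 0 := by
  simpa using transPart_add_smul h u 0

theorem immersion_of_frame (h : Function.Bijective (frame F C x)) :
    Function.Injective (fderiv ℝ F x) := by
  intro u v huv
  have h1 : frame F C x (u, 0) = frame F C x (v, 0) := by
    rw [frame_apply, frame_apply, huv]
  exact congrArg Prod.fst (h.1 h1)

/-- The second fundamental form as a bilinear form. -/
theorem exists_bilin_secondForm (h : Function.Bijective (frame F C x)) :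
    ∃ B : LinearMap.BilinForm ℝ E, ∀ u v, secondForm F C x u v = B u v := by
  obtain ⟨ν, hν⟩ := exists_linear_transPart h
  refine ⟨LinearMap.mk₂ ℝ (fun u v => ν (fderiv ℝ (fderiv ℝ F) x u v)) ?_ ?_ ?_ ?_, fun u v => ?_⟩
  · intros; simp
  · intros; simp
  · intros; simp
  · intros; simp
  · rw [LinearMap.mk₂_apply, secondForm, hν]

theorem snoc_comp_update [DecidableEq (Fin m)] (L : E →ₗ[ℝ] Fin (m + 1) → ℝ)
    (c : Fin (m + 1) → ℝ) (X : Fin m → E) (i : Fin m) (y : E) :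
    (Fin.snoc (α := fun _ => Fin (m + 1) → ℝ) (fun j => L (Function.update X i y j)) c :
      Fin (m + 1) → Fin (m + 1) → ℝ) =
      Function.update (Fin.snoc (α := fun _ => Fin (m + 1) → ℝ) (fun j => L (X j)) c)
        i.castSucc (L y) := by
  rw [← Fin.snoc_update]
  congr 1
  funext j
  by_cases hj : j = i
  · subst hj; simp
  · simp [hj]

/-- `inducedVol` as an alternating form. -/
def volForm (L : E →ₗ[ℝ] Fin (m + 1) → ℝ) (c : Fin (m + 1) → ℝ) : E [⋀^Fin m]→ₗ[ℝ] ℝ where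
  toFun X := Matrix.det (Matrix.of
    (Fin.snoc (α := fun _ => Fin (m + 1) → ℝ) (fun i => L (X i)) c))
  map_update_add' X i a b := by
    rw [snoc_comp_update, snoc_comp_update, snoc_comp_update, map_add]
    exact Matrix.detRowAlternating.map_update_add _ _ _ _
  map_update_smul' X i r a := by
    rw [snoc_comp_update, snoc_comp_update, map_smul]
    exact Matrix.detRowAlternating.map_update_smul _ _ _ _
  map_eq_zero_of_eq' X i j hX hij := by
    refine Matrix.det_zero_of_row_eq (i := i.castSucc) (j := j.castSucc) ?_ ?_
    · exact fun h => hij (Fin.castSucc_injective _ h)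
    · funext k
      simp [hX]

theorem inducedVol_eq (F C : E → Fin (m + 1) → ℝ) (x : E) (X : Fin m → E) :
    inducedVol F C x X = volForm (fderiv ℝ F x : E →ₗ[ℝ] Fin (m + 1) → ℝ) (C x) X := rfl

end Frame

/-! ### Gram determinants against volume forms -/

theorem det_bilin_eq_mul_det_sq {ι V : Type*} [Fintype ι] [DecidableEq ι] [AddCommGroup V]
    [Module ℝ V] (e : Module.Basis ι ℝ V) (B : LinearMap.BilinForm ℝ V) (X : ι → V) :
    Matrix.det (Matrix.of fun i j => B (X i) (X j)) =
      e.det X ^ 2 * Matrix.det (Matrix.of fun i j => B (e i) (e j)) := by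
  have h : (Matrix.of fun i j => B (X i) (X j)) =
      (e.toMatrix X).transpose * (Matrix.of fun i j => B (e i) (e j)) * e.toMatrix X := by
    ext i j
    simp only [Matrix.of_apply, Matrix.mul_apply, Matrix.transpose_apply]
    conv_lhs => rw [← e.sum_toMatrix_smul_self X i, ← e.sum_toMatrix_smul_self X j]
    simp only [map_sum, LinearMap.sum_apply, map_smul, LinearMap.smul_apply, smul_eq_mul,
      Finset.sum_mul, Finset.mul_sum]
    refine Finset.sum_congr rfl fun k _ => Finset.sum_congr rfl fun l _ => ?_
    ring
  rw [h, Matrix.det_mul, Matrix.det_mul, Matrix.det_transpose, Module.Basis.det_apply]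
  ring

/-- Both sides scale by the square of the determinant of X in the basis e, so a single basis decides
the identity for every family, dependent ones included. -/
theorem abs_det_bilin_eq_of_basis {ι V : Type*} [Fintype ι] [DecidableEq ι] [AddCommGroup V]
    [Module ℝ V] (e : Module.Basis ι ℝ V) (B : LinearMap.BilinForm ℝ V) (Θ : V [⋀^ι]→ₗ[ℝ] ℝ)
    {k : ℝ} (h : |Matrix.det (Matrix.of fun i j => B (e i) (e j))| = k * Θ e ^ 2) (X : ι → V) :
    |Matrix.det (Matrix.of fun i j => B (X i) (X j))| = k * Θ X ^ 2 := by
  have hΘ : Θ X = Θ e * e.det X := by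
    conv_lhs => rw [Θ.eq_smul_basis_det e]
    simp
  rw [det_bilin_eq_mul_det_sq e B X, abs_mul, h, hΘ, abs_of_nonneg (sq_nonneg _)]
  ring

theorem linearIndependent_snoc_of_frame {V W : Type*} [AddCommGroup V] [Module ℝ V]
    [AddCommGroup W] [Module ℝ W] {m : ℕ} (L : V →ₗ[ℝ] W) (c : W)
    (h : Function.Injective (L.coprod (LinearMap.toSpanSingleton ℝ W c)))
    {X : Fin m → V} (hX : LinearIndependent ℝ X) :
    LinearIndependent ℝ (Fin.snoc (α := fun _ => W) (fun i => L (X i)) c : Fin (m + 1) → W) := by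
  have hinj : Function.Injective L := by
    intro u v huv
    have h1 : L.coprod (LinearMap.toSpanSingleton ℝ W c) (u, 0) =
        L.coprod (LinearMap.toSpanSingleton ℝ W c) (v, 0) := by simp [huv]
    exact congrArg Prod.fst (h h1)
  rw [linearIndependent_finSnoc]
  refine ⟨hX.map' L (LinearMap.ker_eq_bot.2 hinj), fun hc => ?_⟩
  have hle : Submodule.span ℝ (Set.range fun i => L (X i)) ≤ LinearMap.range L := by
    rw [Submodule.span_le]
    rintro _ ⟨i, rfl⟩
    exact ⟨X i, rfl⟩
  obtain ⟨u, hu⟩ := hle hc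
  have h1 : L.coprod (LinearMap.toSpanSingleton ℝ W c) (u, -1) =
      L.coprod (LinearMap.toSpanSingleton ℝ W c) (0, 0) := by simp [hu]
  exact absurd (congrArg Prod.snd (h h1)) (by norm_num)

theorem det_ne_zero_of_linearIndependent {m : ℕ} {v : Fin m → Fin m → ℝ}
    (h : LinearIndependent ℝ v) : Matrix.det (Matrix.of v) ≠ 0 := by
  have := (Matrix.linearIndependent_rows_iff_isUnit (A := Matrix.of v)).1 h
  exact ((Matrix.isUnit_iff_isUnit_det _).1 this).ne_zero

/-- The determinant as a continuous multilinear function of the rows. -/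
def detRowCLM (k : ℕ) : ContinuousMultilinearMap ℝ (fun _ : Fin k => Fin k → ℝ) ℝ where
  toMultilinearMap := (Matrix.detRowAlternating (n := Fin k) (R := ℝ)).toMultilinearMap
  cont := Continuous.matrix_det continuous_id

/-! ### Derivative of the induced volume and the vanishing of τ -/

section Frame

variable {E : Type*} [NormedAddCommGroup E] [NormedSpace ℝ E] {m : ℕ}
  {F C : E → Fin (m + 1) → ℝ} {x : E}

/-- This is ∇Θ = τ ⊗ Θ. Differentiate the determinant row by row: in the rows F_*X_i only the
tangential part ∇_u X_i survives, because the C-part repeats the last row; in the last row only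
τ(u)C survives. -/
theorem fderiv_inducedVol [FiniteDimensional ℝ E] (hm : Module.finrank ℝ E = m)
    (hF : ContDiffAt ℝ 2 F x) (hC : DifferentiableAt ℝ C x)
    (hb : Function.Bijective (frame F C x)) (u : E) (X : Fin m → E) :
    fderiv ℝ (fun y => inducedVol F C y X) x u =
      ∑ i, inducedVol F C x (Function.update X i (nablaConst F C x u (X i))) +
        transPart F C x (fderiv ℝ C x u) * inducedVol F C x X := by
  have hdF : DifferentiableAt ℝ (fderiv ℝ F) x :=
    (hF.fderiv_right (m := 1) (by norm_num)).differentiableAt (by norm_num)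
  set L : E →ₗ[ℝ] Fin (m + 1) → ℝ := (fderiv ℝ F x : E →ₗ[ℝ] Fin (m + 1) → ℝ) with hL
  let r : E → Fin (m + 1) → Fin (m + 1) → ℝ := fun y =>
    Fin.snoc (α := fun _ => Fin (m + 1) → ℝ) (fun i => fderiv ℝ F y (X i)) (C y)
  let r' : Fin (m + 1) → E →L[ℝ] (Fin (m + 1) → ℝ) :=
    Fin.snoc (α := fun _ => E →L[ℝ] (Fin (m + 1) → ℝ))
      (fun i => (fderiv ℝ (fderiv ℝ F) x).flip (X i)) (fderiv ℝ C x)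
  have hr : HasFDerivAt r (ContinuousLinearMap.pi r') x := by
    rw [hasFDerivAt_pi]
    intro i
    refine Fin.lastCases ?_ (fun i => ?_) i
    · simpa [r, r'] using hC.hasFDerivAt
    · have h := hdF.hasFDerivAt.clm_apply (hasFDerivAt_const (X i) x)
      simpa [r, r'] using h
  have h1 : HasFDerivAt (fun y => inducedVol F C y X) _ x :=
    ((detRowCLM (m + 1)).hasFDerivAt (r x)).comp x hr
  rw [h1.fderiv, ContinuousLinearMap.comp_apply, ContinuousMultilinearMap.linearDeriv_apply,
    Fin.sum_univ_castSucc]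
  have hrx : r x = Fin.snoc (α := fun _ => Fin (m + 1) → ℝ) (fun i => L (X i)) (C x) := rfl
  congr 1
  · refine Finset.sum_congr rfl fun i _ => ?_
    have e1 : ContinuousLinearMap.pi r' u i.castSucc = fderiv ℝ (fderiv ℝ F) x u (X i) := by
      simp [r']
    rw [e1, eq_tanPart_add_transPart hb (fderiv ℝ (fderiv ℝ F) x u (X i)),
      ContinuousMultilinearMap.map_update_add, ContinuousMultilinearMap.map_update_smul]
    have e2 : detRowCLM (m + 1) (Function.update (r x) i.castSucc (C x)) = 0 := by
      refine Matrix.det_zero_of_row_eq (i := i.castSucc) (j := Fin.last m)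
        (Fin.castSucc_lt_last i).ne ?_
      funext k
      simp [r, Function.update_of_ne (Fin.castSucc_lt_last i).ne']
    rw [e2, smul_zero, add_zero, inducedVol_eq, hrx]
    change _ = Matrix.det (Matrix.of _)
    rw [snoc_comp_update]
    rfl
  · have e1 : ContinuousLinearMap.pi r' u (Fin.last m) = fderiv ℝ C x u := by
      simp [r']
    rw [e1, eq_tanPart_add_transPart hb (fderiv ℝ C x u),
      ContinuousMultilinearMap.map_update_add, ContinuousMultilinearMap.map_update_smul,
      transPart_add_smul hb]
    -- All m + 1 rows are now images under F_* of vectors of an m-dimensional space, hence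
    -- dependent.
    have e2 : detRowCLM (m + 1) (Function.update (r x) (Fin.last m)
        (fderiv ℝ F x (tanPart F C x (fderiv ℝ C x u)))) = 0 := by
      let Y : Fin (m + 1) → E := Fin.snoc (α := fun _ => E) X (tanPart F C x (fderiv ℝ C x u))
      have hY : ¬ LinearIndependent ℝ Y := fun h => by
        have := h.fintype_card_le_finrank
        rw [Fintype.card_fin, hm] at this
        omega
      have h0 := (Matrix.detRowAlternating.compLinearMap L).map_linearDependent Y hY
      rw [← h0]
      change Matrix.detRowAlternating _ = Matrix.detRowAlternating _
      congr 1
      funext i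
      refine Fin.lastCases ?_ (fun i => ?_) i
      · simp [Y, hL]
      · simp [Y, hL, r]
    rw [e2, zero_add, hrx, Fin.update_snoc_last]
    rfl

theorem inducedVol_ne_zero (hb : Function.Bijective (frame F C x)) {X : Fin m → E}
    (hX : LinearIndependent ℝ X) : inducedVol F C x X ≠ 0 :=
  det_ne_zero_of_linearIndependent (linearIndependent_snoc_of_frame _ _ hb.1 hX)

/-- On a basis Θ ≠ 0, so squaring ω_h = Θ removes the sign; the identity then extends to all
families by scaling. In this squared form the volume condition is insensitive to orientation. -/
theorem abs_det_eq_inducedVol_sq [FiniteDimensional ℝ E] (hm : Module.finrank ℝ E = m)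
    (hb : Function.Bijective (frame F C x)) (h : ∀ X, metricVol F C x X = inducedVol F C x X)
    (X : Fin m → E) :
    |Matrix.det (Matrix.of fun i j => secondForm F C x (X i) (X j))| = inducedVol F C x X ^ 2 := by
  obtain ⟨B, hB⟩ := exists_bilin_secondForm hb
  let b := Module.finBasisOfFinrankEq ℝ E hm
  have h0 := inducedVol_ne_zero hb b.linearIndependent
  have h1 := h b
  have h2 : |Matrix.det (Matrix.of fun i j => secondForm F C x (b i) (b j))| =
      1 * inducedVol F C x b ^ 2 := by
    rw [one_mul, ← h1, metricVol, mul_pow, Real.sq_sqrt (abs_nonneg _)]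
    rcases Real.sign_apply_eq_of_ne_zero _ h0 with h3 | h3 <;> rw [h3] <;> norm_num
  simp only [hB, inducedVol_eq] at h2 ⊢
  rw [abs_det_bilin_eq_of_basis b B _ h2 X, one_mul]

theorem metricVol_eq_inducedVol
    (h : ∀ X, |Matrix.det (Matrix.of fun i j => secondForm F C x (X i) (X j))| =
      inducedVol F C x X ^ 2) (X : Fin m → E) : metricVol F C x X = inducedVol F C x X := by
  rw [metricVol, h, Real.sqrt_sq_eq_abs]
  rcases lt_trichotomy (inducedVol F C x X) 0 with h | h | h
  · rw [Real.sign_of_neg h, abs_of_neg h]; ring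
  · rw [h]; simp
  · rw [Real.sign_of_pos h, abs_of_pos h]; ring

/-- Comparing ∇Θ = τ ⊗ Θ with ∇ω_h = 0 and ω_h = Θ near x gives τ = 0, which leaves only the shape
term of the Weingarten formula. -/
theorem IsAffineHypersphereOn.fderiv_field [FiniteDimensional ℝ E]
    (hm : Module.finrank ℝ E = m) {lam : ℝ} {U : Set E} (hU : IsOpen U)
    (h : IsAffineHypersphereOn F C lam U) (hx : x ∈ U) (u : E) :
    fderiv ℝ C x u = - (lam • fderiv ℝ F x u) := by
  have hb := h.blaschke.transversal x hx
  let b := Module.finBasisOfFinrankEq ℝ E hm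
  have hF : ContDiffAt ℝ 2 F x :=
    (h.blaschke.smooth.contDiffAt (hU.mem_nhds hx)).of_le (by norm_cast)
  have hC : DifferentiableAt ℝ C x :=
    (h.blaschke.smooth_field.contDiffAt (hU.mem_nhds hx)).differentiableAt (by simp)
  have h1 := fderiv_inducedVol hm hF hC hb u b
  have h2 := h.blaschke.parallel x hx u b
  have h3 : (fun y => metricVol F C y b) =ᶠ[nhds x] fun y => inducedVol F C y b := by
    filter_upwards [hU.mem_nhds hx] with y hy using h.blaschke.volume y hy b
  rw [h3.fderiv_eq, h1] at h2
  simp only [h.blaschke.volume x hx] at h2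
  have h4 : transPart F C x (fderiv ℝ C x u) = 0 := by
    have := inducedVol_ne_zero hb b.linearIndependent
    have h5 : transPart F C x (fderiv ℝ C x u) * inducedVol F C x b = 0 := by linarith
    exact (mul_eq_zero.1 h5).resolve_right this
  rw [eq_tanPart_add_transPart hb (fderiv ℝ C x u), h4, zero_smul, add_zero]
  have h6 := h.shape x hx u
  rw [shapeOp, neg_eq_iff_eq_neg] at h6
  rw [h6, map_neg, map_smul]

end Frame

/-! ### Calculus of f = R_z g and the comparison of invariants -/

section Hyper

variable {E : Type*} [NormedAddCommGroup E] [NormedSpace ℝ E] {n : ℕ}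
  {g ζ : E → RSpace n} {x : E} {z lam a : ℝ} {C : E × ℝ → RSpace n} {F : E × ℝ → RSpace n}

theorem contDiffOn_hyperMap {V : Set E} (hg : ContDiffOn ℝ ∞ g V) (T : Set ℝ) :
    ContDiffOn ℝ ∞ (hyperMap g) (V ×ˢ T) := by
  have h1 : ContDiffOn ℝ ∞ (fun q : E × ℝ => g q.1) (V ×ˢ T) :=
    hg.comp contDiff_fst.contDiffOn fun q hq => hq.1
  have h2 : ContDiffOn ℝ ∞ (fun q : E × ℝ => JtL n (g q.1)) (V ×ˢ T) :=
    (JtL n).contDiff.comp_contDiffOn h1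
  exact ((Real.contDiff_cosh.comp contDiff_snd).contDiffOn.smul h2).sub
    ((Real.contDiff_sinh.comp contDiff_snd).contDiffOn.smul h1)

/-- The z-derivative comes from d/dz R_z = sinh z J - cosh z = -R_z J. -/
theorem hasFDerivAt_hyperMap (hg : DifferentiableAt ℝ g x) (z : ℝ) :
    HasFDerivAt (hyperMap g) ((hyperRot n z).comp ((fderiv ℝ g x).comp
      (ContinuousLinearMap.fst ℝ E ℝ) - (ContinuousLinearMap.snd ℝ E ℝ).smulRight
        (Jt n (g x)))) (x, z) := by
  have h1 : HasFDerivAt (fun q : E × ℝ => g q.1)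
      ((fderiv ℝ g x).comp (ContinuousLinearMap.fst ℝ E ℝ)) (x, z) :=
    HasFDerivAt.comp (x, z) (g := g) hg.hasFDerivAt hasFDerivAt_fst
  have h2 : HasFDerivAt (fun q : E × ℝ => JtL n (g q.1)) _ (x, z) :=
    (JtL n).hasFDerivAt.comp (x, z) h1
  have h0 : HasFDerivAt (fun q : E × ℝ => q.2) (ContinuousLinearMap.snd ℝ E ℝ) (x, z) :=
    hasFDerivAt_snd
  have h3 := h0.cosh
  have h4 := h0.sinh
  refine ((h3.smul h2).sub (h4.smul h1)).congr_fderiv ?_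
  refine ContinuousLinearMap.ext fun p => ?_
  simp only [sub_apply, add_apply,
    smul_apply, ContinuousLinearMap.comp_apply,
    ContinuousLinearMap.smulRight_apply, ContinuousLinearMap.coe_fst', JtL_apply,
    ContinuousLinearMap.coe_snd', hyperRot_apply, map_sub, map_smul, Jt_Jt, smul_eq_mul]
  module

theorem fderiv_hyperMap (hg : DifferentiableAt ℝ g x) (z : ℝ) (p : E × ℝ) :
    fderiv ℝ (hyperMap g) (x, z) p = hyperRot n z (fderiv ℝ g x p.1 - p.2 • Jt n (g x)) := by
  rw [(hasFDerivAt_hyperMap hg z).fderiv]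
  simp

/-- For fixed q, the first derivative in direction q is itself of the form R_z applied to a function
of x, namely g_*q₁ - q₂ Jg, so the first-order formula can be applied a second time. -/
theorem fderiv_fderiv_hyperMap (hg : ContDiffAt ℝ 2 g x) (z : ℝ) (p q : E × ℝ) :
    fderiv ℝ (fderiv ℝ (hyperMap g)) (x, z) p q =
      hyperRot n z (fderiv ℝ (fderiv ℝ g) x p.1 q.1 - q.2 • Jt n (fderiv ℝ g x p.1)
        - p.2 • Jt n (fderiv ℝ g x q.1) + (p.2 * q.2) • g x) := by
  have hdg : DifferentiableAt ℝ (fderiv ℝ g) x :=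
    (hg.fderiv_right (m := 1) (by norm_num)).differentiableAt (by norm_num)
  have hg1 : DifferentiableAt ℝ g x := hg.differentiableAt (by norm_num)
  have hnear : ∀ᶠ y in nhds x, DifferentiableAt ℝ g y := by
    filter_upwards [hg.eventually (by simp)] with y hy using hy.differentiableAt (by norm_num)
  have hd1 : DifferentiableAt ℝ (fun y => fderiv ℝ g y q.1) x :=
    hdg.clm_apply (differentiableAt_const _)
  have hd2 : DifferentiableAt ℝ (fun y => JtL n (g y)) x := (JtL n).differentiableAt.comp x hg1
  have hd : DifferentiableAt ℝ (fun y => fderiv ℝ g y q.1 - q.2 • JtL n (g y)) x :=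
    hd1.sub (hd2.const_smul q.2)
  have heq : (fun r : E × ℝ => fderiv ℝ (hyperMap g) r q) =ᶠ[nhds (x, z)]
      hyperMap (fun y => fderiv ℝ g y q.1 - q.2 • JtL n (g y)) := by
    have := (continuousAt_fst (p := (x, z))).eventually hnear
    filter_upwards [this] with r hr
    rw [fderiv_hyperMap (z := r.2) hr, hyperMap_eq]
    rfl
  have hD : DifferentiableAt ℝ (fderiv ℝ (hyperMap g)) (x, z) := by
    have hc : ContDiffAt ℝ 2 (hyperMap g) (x, z) := by
      have h1 : ContDiffAt ℝ 2 (fun q : E × ℝ => g q.1) (x, z) :=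
        ContDiffAt.comp (x, z) (g := g) hg contDiffAt_fst
      have h2 : ContDiffAt ℝ 2 (fun q : E × ℝ => JtL n (g q.1)) (x, z) :=
        (JtL n).contDiff.contDiffAt.comp (x, z) h1
      exact ((Real.contDiff_cosh.comp contDiff_snd).contDiffAt.smul h2).sub
        ((Real.contDiff_sinh.comp contDiff_snd).contDiffAt.smul h1)
    exact (hc.fderiv_right (m := 1) (by norm_num)).differentiableAt (by norm_num)
  have h1 : fderiv ℝ (fderiv ℝ (hyperMap g)) (x, z) p q =
      fderiv ℝ (fun r : E × ℝ => fderiv ℝ (hyperMap g) r q) (x, z) p := by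
    have h := (hD.hasFDerivAt.clm_apply (hasFDerivAt_const q (x, z))).fderiv
    rw [h]; simp
  have hJ : fderiv ℝ (fun y => JtL n (g y)) x = (JtL n).comp (fderiv ℝ g x) :=
    ((JtL n).hasFDerivAt.comp x hg1.hasFDerivAt).fderiv
  have h2 : fderiv ℝ (fun y => fderiv ℝ g y q.1) x p.1 = fderiv ℝ (fderiv ℝ g) x p.1 q.1 := by
    have h := (hdg.hasFDerivAt.clm_apply (hasFDerivAt_const q.1 x)).fderiv
    rw [h]; simp
  have h3 : fderiv ℝ (fun y => fderiv ℝ g y q.1 - q.2 • JtL n (g y)) x p.1 =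
      fderiv ℝ (fderiv ℝ g) x p.1 q.1 - q.2 • Jt n (fderiv ℝ g x p.1) := by
    have h := hd1.hasFDerivAt.sub (hd2.hasFDerivAt.const_smul q.2)
    rw [hJ] at h
    have h' : HasFDerivAt (fun y => fderiv ℝ g y q.1 - q.2 • JtL n (g y)) _ x := h
    rw [h'.fderiv, sub_apply, h2]
    rfl
  rw [h1, heq.fderiv_eq, fderiv_hyperMap hd, h3]
  congr 1
  simp only [JtL_apply, map_sub, map_smul, Jt_Jt]
  module

/-- `F` agrees up to a translation with `hyperMap g` near `(x, z)`, `C` and `ζ` are the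
corresponding centro-affine transversal fields at that point. -/
structure IsHyperAt (g ζ : E → RSpace n) (F C : E × ℝ → RSpace n) (a lam : ℝ) (x : E) (z : ℝ) :
    Prop where
  smooth : ContDiffAt ℝ 2 g x
  fderiv_eq : fderiv ℝ F =ᶠ[nhds (x, z)] fderiv ℝ (hyperMap g)
  field : C (x, z) = - (lam • hyperMap g (x, z))
  pfield : ζ x = - (a • g x)
  lam_ne : lam ≠ 0
  a_ne : a ≠ 0

namespace IsHyperAt

theorem fderiv_apply (h : IsHyperAt g ζ F C a lam x z) (p : E × ℝ) :
    fderiv ℝ F (x, z) p = hyperRot n z (fderiv ℝ g x p.1 - p.2 • Jt n (g x)) := by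
  rw [h.fderiv_eq.eq_of_nhds, fderiv_hyperMap (h.smooth.differentiableAt (by norm_num))]

theorem fderiv_fderiv_apply (h : IsHyperAt g ζ F C a lam x z) (p q : E × ℝ) :
    fderiv ℝ (fderiv ℝ F) (x, z) p q =
      hyperRot n z (fderiv ℝ (fderiv ℝ g) x p.1 q.1 - q.2 • Jt n (fderiv ℝ g x p.1)
        - p.2 • Jt n (fderiv ℝ g x q.1) + (p.2 * q.2) • g x) := by
  rw [h.fderiv_eq.fderiv_eq, fderiv_fderiv_hyperMap h.smooth]

/-- Here C = -λ R_z g = (λ/a) R_z ζ and f_z = -R_z Jg = (1/a) R_z Jζ. So C fills the ζ-slot and ∂_z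
fills the Jζ-slot. -/
theorem frame_eq (h : IsHyperAt g ζ F C a lam x z) (u : E) (s t : ℝ) :
    frame F C (x, z) ((u, s), t) =
      hyperRot n z (pframe g ζ x (u, t * lam / a, s / a)) := by
  have ha := h.a_ne
  rw [frame_apply, h.fderiv_apply, h.field, hyperMap_eq, pframe_apply, h.pfield]
  simp only [map_add, map_sub, map_smul, map_neg, smul_neg, smul_smul]
  rw [div_mul_cancel₀ _ ha, div_mul_cancel₀ _ ha]
  module

theorem frame_bijective_iff (h : IsHyperAt g ζ F C a lam x z) :
    Function.Bijective (frame F C (x, z)) ↔ Function.Bijective (pframe g ζ x) := by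
  have ha := h.a_ne
  have hl := h.lam_ne
  let e : (E × ℝ) × ℝ ≃ E × ℝ × ℝ :=
    { toFun := fun p => (p.1.1, p.2 * lam / a, p.1.2 / a)
      invFun := fun p => ((p.1, p.2.2 * a), p.2.1 * a / lam)
      left_inv := fun p => by ext <;> simp <;> field_simp
      right_inv := fun p => by ext <;> simp <;> field_simp }
  have h1 : ⇑(frame F C (x, z)) = hyperRot n z ∘ pframe g ζ x ∘ e := by
    funext p
    exact h.frame_eq p.1.1 p.1.2 p.2
  rw [h1, (hyperRot_bijective n z).of_comp_iff', Function.Bijective.of_comp_iff _ e.bijective]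

/-- In the second derivative the mixed terms R_z J g_*u are tangent because g_* T is J-invariant.
The ζ-component of D_u g_*v is rescaled by a/λ, its Jζ-component becomes tangent along ∂_z, and f_zz
= f = -C/λ supplies the last term. -/
theorem secondForm_eq (h : IsHyperAt g ζ F C a lam x z)
    (hb : Function.Bijective (pframe g ζ x)) (hJ : ∀ w ∈ tangent g x, Jt n w ∈ tangent g x)
    (p q : E × ℝ) :
    secondForm F C (x, z) p q = a / lam * pform1 g ζ x p.1 q.1 - p.2 * q.2 / lam := by
  have ha := h.a_ne
  have hl := h.lam_ne
  obtain ⟨u', hu'⟩ := hJ _ ⟨p.1, rfl⟩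
  obtain ⟨v', hv'⟩ := hJ _ ⟨q.1, rfl⟩
  simp only [ContinuousLinearMap.coe_coe] at hu' hv'
  set r := pparts g ζ x (fderiv ℝ (fderiv ℝ g) x p.1 q.1) with hr
  have h1 : pframe g ζ x (r.1, r.2.1, r.2.2) = fderiv ℝ (fderiv ℝ g) x p.1 q.1 :=
    Function.invFun_eq (hb.2 _)
  have h2 : fderiv ℝ (fderiv ℝ F) (x, z) p q = frame F C (x, z)
      ((r.1 - q.2 • u' - p.2 • v', a * r.2.2), (r.2.1 - p.2 * q.2 / a) * a / lam) := by
    rw [h.fderiv_fderiv_apply, h.frame_eq, ← h1, ← hu', ← hv', pframe_apply, pframe_apply]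
    congr 1
    simp only [map_sub, map_smul, h.pfield]
    rw [div_mul_cancel₀ _ hl, mul_div_cancel_right₀ _ ha, mul_div_cancel_left₀ _ ha]
    simp only [sub_smul, smul_neg, smul_smul, sub_mul, div_mul_cancel₀ _ ha]
    module
  rw [secondForm, h2, transPart, invFun_frame (h.frame_bijective_iff.2 hb)]
  change _ = a / lam * r.2.1 - _
  field_simp

theorem abs_inducedVol_eq (h : IsHyperAt g ζ F C a lam x z) (X : Fin (2 * n) → E) :
    |inducedVol F C (x, z)
        (Fin.snoc (α := fun _ => E × ℝ) (fun i => (X i, (0 : ℝ))) ((0 : E), (1 : ℝ)))| =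
      |lam| / a ^ 2 * |pvol g ζ x X| := by
  have ha := h.a_ne
  let v : Fin (2 * n + 1 + 1) → RSpace n := Fin.snoc (α := fun _ => RSpace n)
      (Fin.snoc (α := fun _ => RSpace n) (fun i => fderiv ℝ g x (X i)) (ζ x)) (Jt n (ζ x))
  -- The row of ∂_z is R_z(a⁻¹ Jζ) and the row of C is R_z((λ/a) ζ). The scalars go into `d`, and
  -- the swap `σ` restores the order ζ, Jζ.
  let d : Fin (2 * n + 1 + 1) → ℝ := Fin.snoc (α := fun _ => ℝ)
      (Fin.snoc (α := fun _ => ℝ) (fun _ => 1) a⁻¹) (lam / a)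
  let σ : Equiv.Perm (Fin (2 * n + 1 + 1)) := Equiv.swap (Fin.last _) (Fin.last _).castSucc
  have hne : (Fin.last (2 * n)).castSucc ≠ Fin.last (2 * n + 1) :=
    (Fin.castSucc_lt_last _).ne
  have h1 : inducedVol F C (x, z)
      (Fin.snoc (α := fun _ => E × ℝ) (fun i => (X i, (0 : ℝ))) ((0 : E), (1 : ℝ))) =
      Matrix.det (Matrix.of fun i => hyperRot n z (d i • v (σ i))) := by
    unfold inducedVol
    congr 2
    funext i
    refine Fin.lastCases ?_ (fun i => ?_) i
    · simp only [Fin.snoc_last, h.field, hyperMap_eq, d, v, σ, Equiv.swap_apply_left,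
        Fin.snoc_castSucc, h.pfield, smul_neg, smul_smul, div_mul_cancel₀ _ ha, map_neg, map_smul]
    · refine Fin.lastCases ?_ (fun i => ?_) i
      · simp only [Fin.snoc_last, Fin.snoc_castSucc, h.fderiv_apply, d, v, σ,
          Equiv.swap_apply_right, h.pfield, map_neg, map_smul, smul_neg, smul_smul,
          inv_mul_cancel₀ ha, map_zero, zero_sub, one_smul]
      · have e1 : i.castSucc.castSucc ≠ Fin.last (2 * n + 1) := (Fin.castSucc_lt_last _).ne
        have e2 : i.castSucc.castSucc ≠ (Fin.last (2 * n)).castSucc := fun h =>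
          (Fin.castSucc_lt_last i).ne (Fin.castSucc_injective _ h)
        simp only [Fin.snoc_castSucc, h.fderiv_apply, d, v, σ,
          Equiv.swap_apply_of_ne_of_ne e1 e2, zero_smul, sub_zero, one_smul]
  have h2 : Matrix.det (Matrix.of fun i => d i • v (σ i)) =
      (∏ i, d i) * (Equiv.Perm.sign σ * Matrix.det (Matrix.of v)) := by
    rw [← Matrix.det_permute]
    exact Matrix.det_mul_column d ((Matrix.of v).submatrix σ id)
  have h3 : ∏ i, d i = lam / a ^ 2 := by
    simp only [Fin.prod_univ_castSucc, d, Fin.snoc_castSucc, Fin.snoc_last, Finset.prod_const_one]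
    field_simp
  have h4 : pvol g ζ x X = Matrix.det (Matrix.of v) := rfl
  rw [h1, det_of_hyperRot, h2, h3, h4, Equiv.Perm.sign_swap hne.symm, abs_mul, abs_mul, abs_div,
    abs_of_nonneg (sq_nonneg a)]
  simp

theorem det_secondForm_eq (h : IsHyperAt g ζ F C a lam x z)
    (hb : Function.Bijective (pframe g ζ x)) (hJ : ∀ w ∈ tangent g x, Jt n w ∈ tangent g x)
    (X : Fin (2 * n) → E) :
    |Matrix.det (Matrix.of fun i j => secondForm F C (x, z)
        ((Fin.snoc (α := fun _ => E × ℝ) (fun i => (X i, (0 : ℝ))) ((0 : E), (1 : ℝ)) :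
          Fin (2 * n + 1) → E × ℝ) i)
        ((Fin.snoc (α := fun _ => E × ℝ) (fun i => (X i, (0 : ℝ))) ((0 : E), (1 : ℝ)) :
          Fin (2 * n + 1) → E × ℝ) j))| =
      |a| ^ (2 * n) / |lam| ^ (2 * n + 1) *
        |Matrix.det (Matrix.of fun i j => pform1 g ζ x (X i) (X j))| := by
  have hl := h.lam_ne
  have hp0 : ∀ u, pform1 g ζ x u 0 = 0 ∧ pform1 g ζ x 0 u = 0 := by
    intro u
    have h0 : pparts g ζ x 0 = 0 := by
      have := Function.leftInverse_invFun hb.1 0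
      rwa [map_zero] at this
    simp [pform1, h0]
  set M : Matrix (Fin (2 * n)) (Fin (2 * n)) ℝ :=
    Matrix.of fun i j => pform1 g ζ x (X i) (X j) with hM
  set N : Matrix (Fin (2 * n + 1)) (Fin (2 * n + 1)) ℝ := Matrix.of fun i j =>
      secondForm F C (x, z)
        ((Fin.snoc (α := fun _ => E × ℝ) (fun i => (X i, (0 : ℝ))) ((0 : E), (1 : ℝ)) :
          Fin (2 * n + 1) → E × ℝ) i)
        ((Fin.snoc (α := fun _ => E × ℝ) (fun i => (X i, (0 : ℝ))) ((0 : E), (1 : ℝ)) :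
          Fin (2 * n + 1) → E × ℝ) j) with hN
  -- The directions X_i and ∂_z are h-orthogonal and h(∂_z, ∂_z) = -1/λ.
  have h1 : N.submatrix finSumFinEquiv finSumFinEquiv =
      Matrix.fromBlocks ((a / lam) • M) 0 0 (Matrix.of fun _ _ : Fin 1 => - (1 / lam)) := by
    have e1 : ∀ i : Fin (2 * n), Fin.castAdd 1 i = i.castSucc := fun i => rfl
    have e2 : ∀ i : Fin 1, Fin.natAdd (2 * n) i = Fin.last (2 * n) := fun i => by
      ext; simp
    ext i j
    rcases i with i | i <;> rcases j with j | j <;>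
      simp [hN, hM, e1, e2, h.secondForm_eq hb hJ, hp0]
  rw [← Matrix.det_submatrix_equiv_self finSumFinEquiv N, h1, Matrix.det_fromBlocks_zero₂₁,
    Matrix.det_smul, Matrix.det_fin_one, Fintype.card_fin, Matrix.of_apply, abs_mul, abs_mul,
    abs_pow, abs_div, abs_neg, abs_div, abs_one, div_pow]
  field_simp
  ring

end IsHyperAt

end Hyper

/-! ### From the para-complex hypersphere g to the hypersurface f -/

section Hyper

variable {E : Type*} [NormedAddCommGroup E] [NormedSpace ℝ E] {n : ℕ}
  {g ζ : E → RSpace n} {x : E} {z lam a : ℝ}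

theorem linearIndependent_snoc_prod {m : ℕ} {b : Fin m → E} (hb : LinearIndependent ℝ b) :
    LinearIndependent ℝ (Fin.snoc (α := fun _ => E × ℝ) (fun i => (b i, (0 : ℝ)))
      ((0 : E), (1 : ℝ)) : Fin (m + 1) → E × ℝ) := by
  refine linearIndependent_snoc_of_frame (LinearMap.inl ℝ E ℝ) _ (fun p q h => ?_) hb
  simpa [Prod.ext_iff] using h

theorem exists_basis_snoc_prod [FiniteDimensional ℝ E] {m : ℕ}
    (hfin : Module.finrank ℝ E = m) {b : Fin m → E} (hb : LinearIndependent ℝ b) :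
    ∃ e : Module.Basis (Fin (m + 1)) ℝ (E × ℝ), ∀ i, e i =
      (Fin.snoc (α := fun _ => E × ℝ) (fun i => (b i, (0 : ℝ)))
      ((0 : E), (1 : ℝ)) : Fin (m + 1) → E × ℝ) i := by
  have h := linearIndependent_snoc_prod hb
  have hc : Fintype.card (Fin (m + 1)) = Module.finrank ℝ (E × ℝ) := by
    rw [Fintype.card_fin, Module.finrank_prod, hfin, Module.finrank_self]
  exact ⟨basisOfLinearIndependentOfCardEqFinrank h hc, fun i =>
    congrFun (coe_basisOfLinearIndependentOfCardEqFinrank h hc) i⟩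

/-- J f_z = -f is transversal, whereas J f_*(u, 0) = R_z J g_*u is tangent. So only vectors without
∂_z-component remain tangent under J. -/
theorem mem_distr_hyperMap_iff (hg : DifferentiableAt ℝ g x) (ha : a ≠ 0)
    (hζ : ζ x = - (a • g x)) (hb : Function.Bijective (pframe g ζ x))
    (hJ : ∀ w ∈ tangent g x, Jt n w ∈ tangent g x) (z : ℝ) (p : E × ℝ) :
    p ∈ distr (hyperMap g) (x, z) ↔ p.2 = 0 := by
  obtain ⟨u, s⟩ := p
  simp only [distr, Submodule.mem_comap, ContinuousLinearMap.coe_coe, Submodule.mem_inf,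
    Submodule.mem_map, tangent, LinearMap.mem_range, exists_exists_eq_and, fderiv_hyperMap hg,
    Jt_hyperRot]
  constructor
  · rintro ⟨-, q, hq⟩
    have h1 := (hyperRot_bijective n z).1 hq
    obtain ⟨u', hu'⟩ := hJ _ ⟨q.1, rfl⟩
    rw [map_sub, map_smul, Jt_Jt] at h1
    have h2 : pframe g ζ x (u', q.2 / a, 0) = pframe g ζ x (u, 0, s / a) := by
      rw [pframe_apply, pframe_apply, hζ]
      simp only [map_neg, map_smul, smul_neg, smul_smul, div_mul_cancel₀ _ ha, zero_smul, zero_mul,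
        neg_zero, add_zero, ← sub_eq_add_neg, zero_sub]
      rw [← h1]
      exact congrArg (· - q.2 • g x) hu'
    have h3 := congrArg (fun r : E × ℝ × ℝ => r.2.2) (hb.1 h2)
    simp only [eq_comm, div_eq_zero_iff, ha, or_false] at h3
    exact h3
  · rintro rfl
    obtain ⟨u', hu'⟩ := hJ _ ⟨u, rfl⟩
    refine ⟨⟨(u, 0), rfl⟩, (u', 0), ?_⟩
    rw [ContinuousLinearMap.coe_coe] at hu'
    simp [hu', Jt_Jt]

theorem isInvolutiveOn_of_distr_iff {F : E × ℝ → RSpace n} {U : Set (E × ℝ)} (hU : IsOpen U)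
    (h : ∀ q ∈ U, ∀ p : E × ℝ, p ∈ distr F q ↔ p.2 = 0) : IsInvolutiveOn F U := by
  intro X Y hX hY hXD hYD q hq
  have key : ∀ Z : E × ℝ → E × ℝ, ContDiffOn ℝ ∞ Z U → (∀ r ∈ U, Z r ∈ distr F r) →
      ∀ p, (fderiv ℝ Z q p).2 = 0 := by
    intro Z hZ hZD p
    have hd : DifferentiableAt ℝ Z q :=
      (hZ.contDiffAt (hU.mem_nhds hq)).differentiableAt (by simp)
    have h1 : (fun r => (Z r).2) =ᶠ[nhds q] fun _ => 0 := by
      filter_upwards [hU.mem_nhds hq] with r hr using (h r hr _).1 (hZD r hr)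
    have h2 := h1.fderiv_eq (𝕜 := ℝ)
    have h3 : HasFDerivAt (fun r => (Z r).2) _ q := hd.hasFDerivAt.snd
    rw [h3.fderiv] at h2
    simpa using congrArg (fun l : E × ℝ →L[ℝ] ℝ => l p) h2
  rw [h q hq, VectorField.lieBracket, Prod.snd_sub, key Y hY hYD, key X hX hXD, sub_zero]

theorem pvol_smul (d : Fin (2 * n) → ℝ) (X : Fin (2 * n) → E) :
    pvol g ζ x (fun i => d i • X i) = (∏ i, d i) * pvol g ζ x X := by
  let v : Fin (2 * n + 1 + 1) → RSpace n := Fin.snoc (α := fun _ => RSpace n)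
      (Fin.snoc (α := fun _ => RSpace n) (fun i => fderiv ℝ g x (X i)) (ζ x)) (Jt n (ζ x))
  let c : Fin (2 * n + 1 + 1) → ℝ := Fin.snoc (α := fun _ => ℝ)
      (Fin.snoc (α := fun _ => ℝ) d 1) 1
  have h1 : pvol g ζ x (fun i => d i • X i) = Matrix.det (Matrix.of fun i => c i • v i) := by
    unfold pvol
    congr 2
    funext i
    refine Fin.lastCases ?_ (fun i => ?_) i
    · simp [c, v]
    · refine Fin.lastCases ?_ (fun i => ?_) i
      · simp [c, v]
      · simp [c, v]
  have h2 : ∏ i, c i = ∏ i, d i := by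
    simp only [Fin.prod_univ_castSucc, c, Fin.snoc_castSucc, Fin.snoc_last, mul_one]
  rw [h1, ← h2]
  exact Matrix.det_mul_column c (Matrix.of v)

/-- Rescaling one vector of a basis achieves θ_ζ = 1, where the normalization applies. There must be
a vector to rescale, whence n ≠ 0. -/
theorem IsParaAffineNormalOn.exists_normalized_frame [FiniteDimensional ℝ E]
    (hfin : Module.finrank ℝ E = 2 * n) (hn : n ≠ 0) {U : Set E}
    (h : IsParaAffineNormalOn g ζ U) (hx : x ∈ U)
    (hne : ∀ X : Fin (2 * n) → E, LinearIndependent ℝ X → pvol g ζ x X ≠ 0) :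
    ∃ X : Fin (2 * n) → E, LinearIndependent ℝ X ∧
      |Matrix.det (Matrix.of fun i j => pform1 g ζ x (X i) (X j))| =
        1 * pvol g ζ x X ^ 2 := by
  let b := Module.finBasisOfFinrankEq ℝ E hfin
  have hb := hne b b.linearIndependent
  let i₀ : Fin (2 * n) := ⟨0, by omega⟩
  let d : Fin (2 * n) → ℝ := Function.update 1 i₀ (pvol g ζ x b)⁻¹
  have hd : ∏ i, d i = (pvol g ζ x b)⁻¹ := by
    rw [Finset.prod_update_of_mem (Finset.mem_univ _)]
    simp
  have hd0 : ∀ i, d i ≠ 0 := fun i hi =>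
    inv_ne_zero hb (hd ▸ Finset.prod_eq_zero (Finset.mem_univ i) hi)
  have h1 : pvol g ζ x (fun i => d i • b i) = 1 := by
    rw [pvol_smul, hd, inv_mul_cancel₀ hb]
  refine ⟨fun i => d i • b i, ?_, ?_⟩
  · exact b.linearIndependent.units_smul fun i => Units.mk0 (d i) (hd0 i)
  · rw [h.normalized x hx _ h1, h1]; norm_num

theorem IsParaHypersphereOn.isHyperAt {U : Set E} (hU : IsOpen U)
    (h : IsParaHypersphereOn g ζ a U) (ha : a ≠ 0) (hl : lam ≠ 0)
    (hζ : ∀ x ∈ U, ζ x = - (a • g x)) (hx : x ∈ U) (z : ℝ) :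
    IsHyperAt g ζ (hyperMap g) (fun q => - (lam • hyperMap g q)) a lam x z where
  smooth := (h.normal.smooth.contDiffAt (hU.mem_nhds hx)).of_le (by norm_cast)
  fderiv_eq := .rfl
  field := rfl
  pfield := hζ x hx
  lam_ne := hl
  a_ne := ha

theorem IsParaHypersphereOn.pvol_ne_zero {U : Set E} (hU : IsOpen U)
    (h : IsParaHypersphereOn g ζ a U) (ha : a ≠ 0)
    (hζ : ∀ x ∈ U, ζ x = - (a • g x)) (hx : x ∈ U) {X : Fin (2 * n) → E}
    (hX : LinearIndependent ℝ X) : pvol g ζ x X ≠ 0 := by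
  -- The values λ = 1 and z = 0 are arbitrary: any nonzero λ makes Θ a nonzero multiple of θ_ζ up to
  -- sign.
  have hA := h.isHyperAt hU ha one_ne_zero hζ hx 0
  have h1 := inducedVol_ne_zero (hA.frame_bijective_iff.2 (h.normal.transversal x hx))
    (linearIndependent_snoc_prod hX)
  intro h0
  have h2 := hA.abs_inducedVol_eq X
  rw [h0, abs_zero, mul_zero, abs_eq_zero] at h2
  exact h1 h2

/-- With |det h_1| = κ θ_ζ², the condition |det h| = Θ² on one frame reads |a|^{2n} κ / λ^{2n+1} =
λ² / a⁴, which is `hlam`. Parallelism is then automatic: ω_h = Θ, and C = -λf has τ = 0. -/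
theorem IsParaHypersphereOn.isAffineHypersphereOn_hyperMap [FiniteDimensional ℝ E]
    (hfin : Module.finrank ℝ E = 2 * n) {U : Set E} (hU : IsOpen U)
    (h : IsParaHypersphereOn g ζ a U) (ha : a ≠ 0) (hζ : ∀ x ∈ U, ζ x = - (a • g x))
    {κ : ℝ} (hκ : ∀ x ∈ U, ∃ X : Fin (2 * n) → E, LinearIndependent ℝ X ∧
      |Matrix.det (Matrix.of fun i j => pform1 g ζ x (X i) (X j))| = κ * pvol g ζ x X ^ 2)
    (hl : 0 < lam) (hlam : lam ^ (2 * n + 3) = κ * |a| ^ (2 * n + 4)) :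
    IsAffineHypersphereOn (hyperMap g) (fun q => - (lam • hyperMap g q)) lam
      (U ×ˢ (Set.univ : Set ℝ)) := by
  have hO : IsOpen (U ×ˢ (Set.univ : Set ℝ)) := hU.prod isOpen_univ
  have hfin' : Module.finrank ℝ (E × ℝ) = 2 * n + 1 := by
    rw [Module.finrank_prod, hfin, Module.finrank_self]
  have hA : ∀ q ∈ U ×ˢ (Set.univ : Set ℝ),
      IsHyperAt g ζ (hyperMap g) (fun q => - (lam • hyperMap g q)) a lam q.1 q.2 :=
    fun q hq => h.isHyperAt hU ha hl.ne' hζ hq.1 q.2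
  have hF : ContDiffOn ℝ ∞ (hyperMap g) (U ×ˢ (Set.univ : Set ℝ)) :=
    contDiffOn_hyperMap h.normal.smooth _
  have hC : ContDiffOn ℝ ∞ (fun q => - (lam • hyperMap g q)) (U ×ˢ (Set.univ : Set ℝ)) :=
    (hF.const_smul lam).neg
  have hfr : ∀ q ∈ U ×ˢ (Set.univ : Set ℝ),
      Function.Bijective (frame (hyperMap g) (fun q => - (lam • hyperMap g q)) q) :=
    fun q hq => (hA q hq).frame_bijective_iff.2 (h.normal.transversal q.1 hq.1)
  have hform : ∀ q ∈ U ×ˢ (Set.univ : Set ℝ), ∀ p r : E × ℝ,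
      secondForm (hyperMap g) (fun q => - (lam • hyperMap g q)) q p r =
        a / lam * pform1 g ζ q.1 p.1 r.1 - p.2 * r.2 / lam := fun q hq =>
    (hA q hq).secondForm_eq (h.normal.transversal q.1 hq.1) (h.normal.paraComplex q.1 hq.1).1
  have hdC : ∀ q ∈ U ×ˢ (Set.univ : Set ℝ), ∀ p,
      fderiv ℝ (fun q => - (lam • hyperMap g q)) q p = fderiv ℝ (hyperMap g) q (- (lam • p)) := by
    intro q hq p
    have hd : DifferentiableAt ℝ (hyperMap g) q :=
      (hF.contDiffAt (hO.mem_nhds hq)).differentiableAt (by simp)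
    have h1 : HasFDerivAt (fun q => - (lam • hyperMap g q)) _ q :=
      (hd.hasFDerivAt.const_smul lam).neg
    rw [h1.fderiv]
    simp
  have hvol : ∀ q ∈ U ×ˢ (Set.univ : Set ℝ), ∀ X : Fin (2 * n + 1) → E × ℝ,
      metricVol (hyperMap g) (fun q => - (lam • hyperMap g q)) q X =
        inducedVol (hyperMap g) (fun q => - (lam • hyperMap g q)) q X := by
    intro q hq
    obtain ⟨X, hX, hXk⟩ := hκ q.1 hq.1
    obtain ⟨e, he'⟩ := exists_basis_snoc_prod hfin hX
    have he := funext he'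
    obtain ⟨B, hB⟩ := exists_bilin_secondForm (hfr q hq)
    have h1 := (hA q hq).det_secondForm_eq (h.normal.transversal q.1 hq.1)
      (h.normal.paraComplex q.1 hq.1).1 X
    have h2 := (hA q hq).abs_inducedVol_eq X
    have h3 : |Matrix.det (Matrix.of fun i j => B (e i) (e j))| = 1 *
        inducedVol (hyperMap g) (fun q => - (lam • hyperMap g q)) q e ^ 2 := by
      simp only [← hB, he]
      rw [← sq_abs (inducedVol _ _ _ _)]
      refine h1.trans ?_
      rw [h2, hXk, abs_of_pos hl, one_mul, mul_pow, sq_abs]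
      have e1 : a ^ 2 = |a| ^ 2 := (sq_abs a).symm
      have ha' : |a| ≠ 0 := abs_ne_zero.2 ha
      have hl' := hl.ne'
      rw [e1, ← mul_assoc]
      congr 1
      rw [div_pow, div_mul_eq_mul_div, div_eq_div_iff (by positivity) (by positivity)]
      calc |a| ^ (2 * n) * κ * (|a| ^ 2) ^ 2 = κ * |a| ^ (2 * n + 4) := by ring
        _ = lam ^ 2 * lam ^ (2 * n + 1) := by rw [← hlam]; ring
    intro Y
    refine metricVol_eq_inducedVol (fun Y => ?_) Y
    simp only [hB]
    rw [inducedVol_eq] at h3 ⊢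
    rw [abs_det_bilin_eq_of_basis e B _ h3 Y, one_mul]
  refine ⟨⟨hF, hC, fun q hq => immersion_of_frame (hfr q hq), hfr, ?_, ?_, hvol⟩, ?_⟩
  · intro q hq p hp
    simp only [hform q hq] at hp
    have h2 : p.2 = 0 := by
      have h1 := hp (0, 1)
      have h0 : pform1 g ζ q.1 p.1 0 = 0 := by
        have := Function.leftInverse_invFun (h.normal.transversal q.1 hq.1).1 0
        rw [map_zero] at this
        simp [pform1, pparts, this]
      simpa [h0, hl.ne'] using h1
    have h1 : p.1 = 0 := by
      refine h.normal.nondegenerate q.1 hq.1 p.1 fun v => ?_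
      have h1 := hp (v, 0)
      simpa [hl.ne', ha] using h1
    exact Prod.ext h1 h2
  · intro q hq p X
    have h3 : (fun y => metricVol (hyperMap g) (fun q => - (lam • hyperMap g q)) y X)
        =ᶠ[nhds q] fun y => inducedVol (hyperMap g) (fun q => - (lam • hyperMap g q)) y X := by
      filter_upwards [hO.mem_nhds hq] with y hy using hvol y hy X
    rw [h3.fderiv_eq, fderiv_inducedVol hfin' ((hF.contDiffAt (hO.mem_nhds hq)).of_le
      (by norm_cast)) ((hC.contDiffAt (hO.mem_nhds hq)).differentiableAt (by simp)) (hfr q hq),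
      hdC q hq, transPart_fderiv (hfr q hq), zero_mul, add_zero]
    exact Finset.sum_congr rfl fun i _ => (hvol q hq _).symm
  · intro q hq p
    have h1 := tanPart_add_smul (hfr q hq) (- (lam • p)) 0
    rw [zero_smul, add_zero] at h1
    rw [shapeOp, hdC q hq, h1, neg_neg]

theorem isJTangentOn_hyperMap {U : Set E} (hg : ∀ x ∈ U, DifferentiableAt ℝ g x) (lam : ℝ) :
    IsJTangentOn (hyperMap g) (fun q => - (lam • hyperMap g q)) (U ×ˢ (Set.univ : Set ℝ)) := by
  intro q hq
  -- f_z = -Jf gives JC = -λJf = λ f_z.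
  refine ⟨(0, lam), ?_⟩
  change _ = Jt n (- (lam • hyperMap g q))
  rw [ContinuousLinearMap.coe_coe, fderiv_hyperMap (hg q.1 hq.1), map_neg, map_smul,
    hyperMap_eq, Jt_hyperRot]
  simp

theorem IsParaHypersphereOn.isInvolutiveOn_hyperMap {U : Set E} (hU : IsOpen U)
    (h : IsParaHypersphereOn g ζ a U) (ha : a ≠ 0) (hζ : ∀ x ∈ U, ζ x = - (a • g x)) :
    IsInvolutiveOn (hyperMap g) (U ×ˢ (Set.univ : Set ℝ)) :=
  isInvolutiveOn_of_distr_iff (hU.prod isOpen_univ) fun q hq =>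
    mem_distr_hyperMap_iff
      ((h.normal.smooth.contDiffAt (hU.mem_nhds hq.1)).differentiableAt (by simp)) ha
      (hζ q.1 hq.1) (h.normal.transversal q.1 hq.1) (h.normal.paraComplex q.1 hq.1).1 q.2

end Hyper

/-! ### From the hypersurface f back to g -/

section Hyper

variable {E : Type*} [NormedAddCommGroup E] [NormedSpace ℝ E] {n : ℕ}
  {g ζ : E → RSpace n} {x : E} {z lam a : ℝ}

/-- The eigenvectors w ± Jw lie outside T, so T meets each eigenspace, of dimension at most n + 1,
in dimension at most n. By J-invariance T is the sum of the two intersections; as dim T = 2n, both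
have dimension n. -/
theorem isParaComplexSubspace_of_finrank {T : Submodule ℝ (RSpace n)} {w : RSpace n}
    (hT : Module.finrank ℝ T = 2 * n) (hJ : ∀ v ∈ T, Jt n v ∈ T)
    (h1 : w + Jt n w ∉ T) (h2 : w - Jt n w ∉ T) : IsParaComplexSubspace T := by
  have key : ∀ (s : ℝ) (v : RSpace n), (s = 1 ∨ s = -1) → v ∉ T →
      v ∈ Module.End.eigenspace (Jt n) s →
      Module.finrank ℝ (T ⊓ Module.End.eigenspace (Jt n) s : Submodule ℝ (RSpace n)) ≤ n := by
    intro s v hs hvT hv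
    have hlt : T ⊓ Module.End.eigenspace (Jt n) s < Module.End.eigenspace (Jt n) s :=
      lt_of_le_of_ne inf_le_right fun h => hvT ((h.symm ▸ hv : v ∈ T ⊓ _).1)
    have := Submodule.finrank_lt_finrank_of_lt hlt
    have := finrank_eigenspace_le n hs
    omega
  have hp := key 1 _ (.inl rfl) h1 (by
    rw [Module.End.mem_eigenspace_iff, map_add, Jt_Jt, one_smul, add_comm])
  have hm := key (-1) _ (.inr rfl) h2 (by
    rw [Module.End.mem_eigenspace_iff, map_sub, Jt_Jt]; module)
  have hle : T ≤ (T ⊓ Module.End.eigenspace (Jt n) 1) ⊔ (T ⊓ Module.End.eigenspace (Jt n) (-1)) := by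
    intro v hv
    have e : v = (1 / 2 : ℝ) • (v + Jt n v) + (1 / 2 : ℝ) • (v - Jt n v) := by module
    rw [e]
    refine Submodule.add_mem_sup ⟨T.smul_mem _ (T.add_mem hv (hJ v hv)), ?_⟩
      ⟨T.smul_mem _ (T.sub_mem hv (hJ v hv)), ?_⟩
    · refine Submodule.smul_mem _ _ ?_
      rw [Module.End.mem_eigenspace_iff, map_add, Jt_Jt, one_smul, add_comm]
    · refine Submodule.smul_mem _ _ ?_
      rw [Module.End.mem_eigenspace_iff, map_sub, Jt_Jt]; module
  have h3 := Submodule.finrank_mono hle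
  have h4 := Submodule.finrank_add_le_finrank_add_finrank
    (T ⊓ Module.End.eigenspace (Jt n) 1) (T ⊓ Module.End.eigenspace (Jt n) (-1))
  exact ⟨hJ, by omega⟩

theorem exists_pos_pow_eq {c : ℝ} (hc : 0 < c) {k : ℕ} (hk : k ≠ 0) :
    ∃ r : ℝ, 0 < r ∧ r ^ k = c :=
  ⟨c ^ ((k : ℝ)⁻¹), Real.rpow_pos_of_pos hc _, Real.rpow_inv_natCast_pow hc.le hk⟩

/-- The hypotheses concern a single slice z: the comparison of invariants is pointwise, and R_z is
invertible, so one slice recovers everything about g. -/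
theorem isCenteredProperParaHypersphereOn_of_hyper [FiniteDimensional ℝ E]
    (hfin : Module.finrank ℝ E = 2 * n) {V : Set E} (hV : IsOpen V) (hg : ContDiffOn ℝ ∞ g V)
    {F C : E × ℝ → RSpace n} (hl : lam ≠ 0) (z : ℝ)
    (hF : ∀ x ∈ V, fderiv ℝ F =ᶠ[nhds (x, z)] fderiv ℝ (hyperMap g))
    (hC : ∀ x ∈ V, C (x, z) = - (lam • hyperMap g (x, z)))
    (hfr : ∀ x ∈ V, Function.Bijective (frame F C (x, z)))
    (hnd : ∀ x ∈ V, ∀ p, (∀ q, secondForm F C (x, z) p q = 0) → p = 0)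
    (hvol : ∀ x ∈ V, ∀ X : Fin (2 * n + 1) → E × ℝ,
      |Matrix.det (Matrix.of fun i j => secondForm F C (x, z) (X i) (X j))| =
        inducedVol F C (x, z) X ^ 2)
    (hJ : ∀ x ∈ V, ∀ w ∈ tangent g x, Jt n w ∈ tangent g x) :
    IsCenteredProperParaHypersphereOn g V := by
  -- The choice a^{2n+4} = |λ|^{2n+3} is exactly what turns |det h| = Θ² into |det h_1| = θ_ζ².
  obtain ⟨a, ha, hapow⟩ := exists_pos_pow_eq
    (pow_pos (abs_pos.2 hl) (2 * n + 3)) (k := 2 * n + 4) (by omega)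
  have hA : ∀ x ∈ V, IsHyperAt g (fun x => - (a • g x)) F C a lam x z := fun x hx =>
    ⟨(hg.contDiffAt (hV.mem_nhds hx)).of_le (by norm_cast), hF x hx, hC x hx, rfl, hl, ha.ne'⟩
  have hpf : ∀ x ∈ V, Function.Bijective (pframe g (fun x => - (a • g x)) x) := fun x hx =>
    (hA x hx).frame_bijective_iff.1 (hfr x hx)
  have hinj : ∀ x ∈ V, Function.Injective (fderiv ℝ g x) := by
    intro x hx u v huv
    have h1 : pframe g (fun x => - (a • g x)) x (u, 0, 0) =
        pframe g (fun x => - (a • g x)) x (v, 0, 0) := by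
      rw [pframe_apply, pframe_apply, huv]
    exact congrArg Prod.fst ((hpf x hx).1 h1)
  have hdζ : ∀ x ∈ V, ∀ u, pparts g (fun x => - (a • g x)) x
      (fderiv ℝ (fun x => - (a • g x)) x u) = (- (a • u), 0, 0) := by
    intro x hx u
    have hd : DifferentiableAt ℝ g x := (hg.contDiffAt (hV.mem_nhds hx)).differentiableAt (by simp)
    have h1 : HasFDerivAt (fun q => - (a • g q)) _ x := (hd.hasFDerivAt.const_smul a).neg
    have h2 : fderiv ℝ (fun x => - (a • g x)) x u =
        pframe g (fun x => - (a • g x)) x (- (a • u), 0, 0) := by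
      rw [h1.fderiv, pframe_apply]; simp
    rw [h2]
    exact Function.leftInverse_invFun (hpf x hx).1 _
  refine ⟨a, fun x => - (a • g x), ha.ne', ⟨⟨hg, (hg.const_smul a).neg, hinj, ?_, hpf, ?_, ?_, ?_⟩,
    ?_, ?_⟩, fun x _ => rfl⟩
  · intro x hx
    -- Since g = -ζ/a, the vector g + sJg has nonzero ζ-component and is never tangent; s = ±1 gives
    -- the two eigenvectors needed.
    have hnot : ∀ s : ℝ, ∀ u, fderiv ℝ g x u ≠ g x + s • Jt n (g x) := by
      intro s u hu
      have h1 : pframe g (fun x => - (a • g x)) x (u, 0, 0) =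
          pframe g (fun x => - (a • g x)) x (0, - a⁻¹, - (a⁻¹ * s)) := by
        rw [pframe_apply, pframe_apply, hu]
        have e1 : - a⁻¹ * a = -1 := by rw [neg_mul, inv_mul_cancel₀ ha.ne']
        have e2 : - (a⁻¹ * s) * a = - s := by
          rw [neg_mul, mul_right_comm, inv_mul_cancel₀ ha.ne', one_mul]
        simp only [map_neg, map_smul, smul_neg, smul_smul, map_zero, e1, e2]
        module
      have h2 := congrArg (fun r : E × ℝ × ℝ => r.2.1) ((hpf x hx).1 h1)
      simp [ha.ne'] at h2
    refine isParaComplexSubspace_of_finrank (w := g x) ?_ (hJ x hx) ?_ ?_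
    · rw [tangent, LinearMap.finrank_range_of_inj (hinj x hx), hfin]
    · rintro ⟨u, hu⟩
      exact hnot 1 u (by rw [one_smul]; exact hu)
    · rintro ⟨u, hu⟩
      exact hnot (-1) u (by rw [neg_one_smul, ← sub_eq_add_neg]; exact hu)
  · intro x hx u hu
    have h1 := hnd x hx (u, 0) fun q => by
      rw [(hA x hx).secondForm_eq (hpf x hx) (hJ x hx), hu]; simp
    exact congrArg Prod.fst h1
  · intro x hx X hX
    have h1 := (hA x hx).det_secondForm_eq (hpf x hx) (hJ x hx) X
    have h2 := (hA x hx).abs_inducedVol_eq X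
    rw [hvol x hx, ← sq_abs (inducedVol _ _ _ _), h2, hX, abs_one, mul_one, abs_of_pos ha] at h1
    have hl' : |lam| ≠ 0 := abs_ne_zero.2 hl
    have ha' := ha.ne'
    have h3 : a ^ (2 * n + 4) *
        |Matrix.det (Matrix.of fun i j => pform1 g (fun x => - (a • g x)) x (X i) (X j))| =
        a ^ (2 * n + 4) := by
      rw [div_pow, div_mul_eq_mul_div, div_eq_div_iff (by positivity) (by positivity)] at h1
      calc _ = a ^ (2 * n) * |Matrix.det (Matrix.of fun i j =>
              pform1 g (fun x => - (a • g x)) x (X i) (X j))| * (a ^ 2) ^ 2 := by ring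
        _ = |lam| ^ 2 * |lam| ^ (2 * n + 1) := h1.symm
        _ = a ^ (2 * n + 4) := by rw [hapow]; ring
    exact mul_left_cancel₀ (pow_ne_zero _ ha') (by rw [h3, mul_one])
  · intro x hx u
    rw [ptau1, hdζ x hx]
  · intro x hx u
    rw [pshape, hdζ x hx, neg_neg]
  · intro x hx u
    rw [ptau2, hdζ x hx]

end Hyper

/-! ### Behaviour under change of coordinates -/

section Pullback

variable {E E' : Type*} [NormedAddCommGroup E] [NormedSpace ℝ E]
  [NormedAddCommGroup E'] [NormedSpace ℝ E'] {m : ℕ}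
  {F C : E → Fin (m + 1) → ℝ} {θ : E' → E} {q : E'}

theorem fderiv_pullback (hF : DifferentiableAt ℝ F (θ q)) (hθ : DifferentiableAt ℝ θ q) (u : E') :
    fderiv ℝ (fun y => F (θ y)) q u = fderiv ℝ F (θ q) (fderiv ℝ θ q u) := by
  have h : HasFDerivAt (fun y => F (θ y)) _ q := hF.hasFDerivAt.comp q hθ.hasFDerivAt
  rw [h.fderiv]; rfl

theorem frame_pullback_bijective (hF : DifferentiableAt ℝ F (θ q)) (hθ : DifferentiableAt ℝ θ q)
    (hL : Function.Bijective (fderiv ℝ θ q)) (hb : Function.Bijective (frame F C (θ q))) :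
    Function.Bijective (frame (fun y => F (θ y)) (fun y => C (θ y)) q) := by
  have h : ⇑(frame (fun y => F (θ y)) (fun y => C (θ y)) q) =
      frame F C (θ q) ∘ Prod.map (fderiv ℝ θ q) id := by
    funext p
    obtain ⟨u, t⟩ := p
    rw [frame_apply, fderiv_pullback hF hθ, Function.comp_apply, Prod.map_apply, frame_apply]
    rfl
  rw [h]
  exact hb.comp (hL.prodMap Function.bijective_id)

theorem inducedVol_pullback (hF : DifferentiableAt ℝ F (θ q)) (hθ : DifferentiableAt ℝ θ q)
    (X : Fin m → E') :
    inducedVol (fun y => F (θ y)) (fun y => C (θ y)) q X =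
      inducedVol F C (θ q) (fun i => fderiv ℝ θ q (X i)) := by
  simp only [inducedVol, fderiv_pullback hF hθ]

/-- The second derivative of θ enters only through the tangent vector F_*(D²θ(u, v)), which the
transversal component does not see. -/
theorem secondForm_pullback (hF : ContDiffAt ℝ 2 F (θ q)) (hθ : ContDiffAt ℝ 2 θ q)
    (hL : Function.Bijective (fderiv ℝ θ q)) (hb : Function.Bijective (frame F C (θ q)))
    (u v : E') :
    secondForm (fun y => F (θ y)) (fun y => C (θ y)) q u v =
      secondForm F C (θ q) (fderiv ℝ θ q u) (fderiv ℝ θ q v) := by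
  have hF1 : DifferentiableAt ℝ F (θ q) := hF.differentiableAt (by norm_num)
  have hθ1 : DifferentiableAt ℝ θ q := hθ.differentiableAt (by norm_num)
  have hb' := frame_pullback_bijective hF1 hθ1 hL hb
  have hdF : DifferentiableAt ℝ (fderiv ℝ F) (θ q) :=
    (hF.fderiv_right (m := 1) (by norm_num)).differentiableAt (by norm_num)
  have hdθ : DifferentiableAt ℝ (fderiv ℝ θ) q :=
    (hθ.fderiv_right (m := 1) (by norm_num)).differentiableAt (by norm_num)
  have h1 : fderiv ℝ (fun y => F (θ y)) =ᶠ[nhds q]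
      fun y => (fderiv ℝ F (θ y)).comp (fderiv ℝ θ y) := by
    filter_upwards [hθ.eventually (by simp),
      hθ.continuousAt.eventually (hF.eventually (by simp))] with y hy1 hy2
    exact fderiv_comp y (hy2.differentiableAt (by norm_num)) (hy1.differentiableAt (by norm_num))
  have h2 : HasFDerivAt (fun y => fderiv ℝ F (θ y)) _ q :=
    hdF.hasFDerivAt.comp q hθ1.hasFDerivAt
  have h3 : fderiv ℝ (fderiv ℝ (fun y => F (θ y))) q u v =
      fderiv ℝ (fderiv ℝ F) (θ q) (fderiv ℝ θ q u) (fderiv ℝ θ q v) +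
        fderiv ℝ F (θ q) (fderiv ℝ (fderiv ℝ θ) q u v) := by
    rw [h1.fderiv_eq, (h2.clm_comp hdθ.hasFDerivAt).fderiv]
    simp [add_comm]
  obtain ⟨w, hw⟩ := hL.2 (tanPart F C (θ q)
    (fderiv ℝ (fderiv ℝ F) (θ q) (fderiv ℝ θ q u) (fderiv ℝ θ q v)) +
      fderiv ℝ (fderiv ℝ θ) q u v)
  have h4 := eq_tanPart_add_transPart hb
    (fderiv ℝ (fderiv ℝ F) (θ q) (fderiv ℝ θ q u) (fderiv ℝ θ q v))
  have h5 : fderiv ℝ (fderiv ℝ (fun y => F (θ y))) q u v =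
      fderiv ℝ (fun y => F (θ y)) q w +
        secondForm F C (θ q) (fderiv ℝ θ q u) (fderiv ℝ θ q v) • C (θ q) := by
    rw [h3, fderiv_pullback hF1 hθ1, hw, map_add, secondForm]
    conv_lhs => rw [h4]
    abel
  rw [secondForm, h5]
  exact transPart_add_smul hb' _ _

end Pullback

/-! ### The conormal, the form η and its closedness -/

section CentroAffine

variable {E : Type*} [NormedAddCommGroup E] [NormedSpace ℝ E] {n : ℕ}
  {F : E → RSpace n} {U : Set E} {ν : E → RSpace n →L[ℝ] ℝ} {Z : E → E} {x : E}

/-- `ν` is the centro-affine conormal of `F` on `U`, and `Z` is the tangent field with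
`F_* Z = - J F`. -/
structure IsConormalOn (F : E → RSpace n) (ν : E → RSpace n →L[ℝ] ℝ) (Z : E → E) (U : Set E) :
    Prop where
  smooth : ContDiffOn ℝ ∞ F U
  smooth_conormal : ContDiffOn ℝ ∞ ν U
  smooth_field : ContDiffOn ℝ ∞ Z U
  tangent_eq : ∀ x ∈ U, ∀ u, ν x (fderiv ℝ F x u) = 0
  self_eq : ∀ x ∈ U, ν x (F x) = 1
  exists_of_eq_zero : ∀ x ∈ U, ∀ w, ν x w = 0 → ∃ u, fderiv ℝ F x u = w
  injective : ∀ x ∈ U, Function.Injective (fderiv ℝ F x)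
  field_eq : ∀ x ∈ U, fderiv ℝ F x (Z x) = - Jt n (F x)

/-- The components of a vector in the frame `F_* ⊕ C` depend smoothly on the point. -/
theorem exists_smooth_frame_inverse [FiniteDimensional ℝ E] {m : ℕ} {F C : E → Fin (m + 1) → ℝ}
    (hU : IsOpen U) (hF : ContDiffOn ℝ ∞ F U) (hC : ContDiffOn ℝ ∞ C U)
    (hb : ∀ x ∈ U, Function.Bijective (frame F C x)) :
    ∃ Q : E → (Fin (m + 1) → ℝ) →L[ℝ] E × ℝ, ContDiffOn ℝ ∞ Q U ∧
      ∀ x ∈ U, ∀ u (t : ℝ), Q x (fderiv ℝ F x u + t • C x) = (u, t) := by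
  have hE : CompleteSpace E := FiniteDimensional.complete ℝ E
  let A : E → (E × ℝ →L[ℝ] Fin (m + 1) → ℝ) := fun x =>
    (fderiv ℝ F x).comp (ContinuousLinearMap.fst ℝ E ℝ) +
      ContinuousLinearMap.smulRightL ℝ (E × ℝ) (Fin (m + 1) → ℝ)
        (ContinuousLinearMap.snd ℝ E ℝ) (C x)
  have hA : ∀ x p, A x p = frame F C x p := fun x p => by
    rw [frame_apply]; simp [A]
  have hAs : ContDiffOn ℝ ∞ A U :=
    ((hF.fderiv_of_isOpen hU le_rfl).clm_comp contDiffOn_const).add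
      ((ContinuousLinearMap.contDiff _).comp_contDiffOn hC)
  have hAi : ∀ x ∈ U, (A x).IsInvertible := by
    intro x hx
    have hbij : Function.Bijective (A x : E × ℝ →ₗ[ℝ] Fin (m + 1) → ℝ) := by
      have : ⇑(A x : E × ℝ →ₗ[ℝ] Fin (m + 1) → ℝ) = frame F C x := funext (hA x)
      rw [this]; exact hb x hx
    exact ⟨(LinearEquiv.ofBijective _ hbij).toContinuousLinearEquiv, by ext <;> rfl⟩
  refine ⟨fun x => (A x).inverse, fun x hx =>
    (hAi x hx).contDiffAt_map_inverse.comp_contDiffWithinAt x (hAs x hx), fun x hx u t => ?_⟩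
  rw [← frame_apply F C, ← hA, (hAi x hx).inverse_apply_self]

/-- In the centro-affine frame (F_*, F), ν is the coefficient of F and Z the tangential part of -JF;
smoothness is that of the inverse frame. -/
theorem exists_isConormalOn [FiniteDimensional ℝ E] (hU : IsOpen U) (hF : ContDiffOn ℝ ∞ F U)
    (hb : ∀ x ∈ U, Function.Bijective (frame F F x)) (hJ : ∀ x ∈ U, Jt n (F x) ∈ tangent F x) :
    ∃ ν Z, IsConormalOn F ν Z U := by
  obtain ⟨Q, hQ, hinv⟩ := exists_smooth_frame_inverse hU hF hF hb
  refine ⟨fun x => (ContinuousLinearMap.snd ℝ E ℝ).comp (Q x),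
    fun x => (Q x (- JtL n (F x))).1, hF, contDiffOn_const.clm_comp hQ,
    (hQ.clm_apply ((JtL n).contDiff.comp_contDiffOn hF).neg).fst, ?_, ?_, ?_,
    fun x hx => immersion_of_frame (hb x hx), ?_⟩
  · intro x hx u
    have := hinv x hx u 0
    rw [zero_smul, add_zero] at this
    simp [this]
  · intro x hx
    have := hinv x hx 0 1
    rw [map_zero, one_smul, zero_add] at this
    simp [this]
  · intro x hx w hw
    have h1 := eq_tanPart_add_transPart (hb x hx) w
    have h2 : transPart F F x w = 0 := by
      change (Q x w).2 = 0 at hw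
      rw [h1, hinv x hx] at hw
      exact hw
    refine ⟨tanPart F F x w, ?_⟩
    conv_rhs => rw [h1, h2, zero_smul, add_zero]
  · intro x hx
    obtain ⟨u, hu⟩ := hJ x hx
    rw [ContinuousLinearMap.coe_coe] at hu
    have := hinv x hx (-u) 0
    rw [zero_smul, add_zero, map_neg, hu] at this
    rw [JtL_apply, this, map_neg, hu]

/-- The form `η = - ν ∘ J ∘ F_*`, whose kernel is the distribution `𝒟`. -/
def etaForm (F : E → RSpace n) (ν : E → RSpace n →L[ℝ] ℝ) (x : E) : E →L[ℝ] ℝ :=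
  - ((ν x).comp ((JtL n).comp (fderiv ℝ F x)))

theorem etaForm_apply (x u : E) : etaForm F ν x u = - ν x (Jt n (fderiv ℝ F x u)) := rfl

namespace IsConormalOn

theorem etaForm_field (h : IsConormalOn F ν Z U) (hx : x ∈ U) : etaForm F ν x (Z x) = 1 := by
  rw [etaForm_apply, h.field_eq x hx, map_neg, Jt_Jt, map_neg, neg_neg, h.self_eq x hx]

theorem exists_Jt_eq (h : IsConormalOn F ν Z U) (hx : x ∈ U) {u : E}
    (hu : etaForm F ν x u = 0) :
    ∃ w, fderiv ℝ F x w = Jt n (fderiv ℝ F x u) ∧ etaForm F ν x w = 0 := by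
  rw [etaForm_apply, neg_eq_zero] at hu
  obtain ⟨w, hw⟩ := h.exists_of_eq_zero x hx _ hu
  exact ⟨w, hw, by rw [etaForm_apply, hw, Jt_Jt, h.tangent_eq x hx, neg_zero]⟩

theorem mem_distr_iff (h : IsConormalOn F ν Z U) (hx : x ∈ U) (u : E) :
    u ∈ distr F x ↔ etaForm F ν x u = 0 := by
  simp only [distr, Submodule.mem_comap, ContinuousLinearMap.coe_coe, Submodule.mem_inf,
    Submodule.mem_map, tangent, LinearMap.mem_range, exists_exists_eq_and]
  constructor
  · rintro ⟨-, w, hw⟩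
    rw [etaForm_apply, ← hw, Jt_Jt, h.tangent_eq x hx, neg_zero]
  · intro hu
    obtain ⟨w, hw, -⟩ := h.exists_Jt_eq hx hu
    exact ⟨⟨u, rfl⟩, w, by rw [hw, Jt_Jt]⟩

theorem contDiffOn_etaForm (h : IsConormalOn F ν Z U) (hU : IsOpen U) :
    ContDiffOn ℝ ∞ (etaForm F ν) U :=
  (h.smooth_conormal.clm_comp
    (contDiffOn_const.clm_comp (h.smooth.fderiv_of_isOpen hU le_rfl))).neg

/-- This is dη(Z, ·) = 0, valid without involutivity. The second derivatives of F cancel by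
symmetry, leaving (D_Zν)(J F_*b) and (D_bν)(J F_*Z). The latter is -(D_bν)(F), which vanishes on
differentiating ν(F) = 1; the former is `e5`. -/
theorem fderiv_etaForm_field (h : IsConormalOn F ν Z U) (hU : IsOpen U) (hx : x ∈ U) (b : E) :
    fderiv ℝ (etaForm F ν) x (Z x) b = fderiv ℝ (etaForm F ν) x b (Z x) := by
  have hxU := hU.mem_nhds hx
  have hdν : DifferentiableAt ℝ ν x :=
    (h.smooth_conormal.contDiffAt hxU).differentiableAt (by simp)
  have hdZ : DifferentiableAt ℝ Z x :=
    (h.smooth_field.contDiffAt hxU).differentiableAt (by simp)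
  have hdF : DifferentiableAt ℝ F x := (h.smooth.contDiffAt hxU).differentiableAt (by simp)
  have hddF : DifferentiableAt ℝ (fderiv ℝ F) x :=
    ((h.smooth.fderiv_of_isOpen hU (m := ∞) le_rfl).contDiffAt hxU).differentiableAt (by simp)
  have hsymm : ∀ a b, fderiv ℝ (fderiv ℝ F) x a b = fderiv ℝ (fderiv ℝ F) x b a := fun a b =>
    ((h.smooth.contDiffAt hxU).isSymmSndFDerivAt (by simp; norm_cast)) a b
  have e1 : ∀ a b, fderiv ℝ (etaForm F ν) x a b =
      - (ν x (Jt n (fderiv ℝ (fderiv ℝ F) x a b)) + fderiv ℝ ν x a (Jt n (fderiv ℝ F x b))) := by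
    intro a b
    have h1 : HasFDerivAt (etaForm F ν) _ x := (hdν.hasFDerivAt.clm_comp
      ((hasFDerivAt_const (JtL n) x).clm_comp hddF.hasFDerivAt)).neg
    rw [h1.fderiv]
    simp
  have e2 : ∀ a, fderiv ℝ ν x a (F x) = 0 := by
    intro a
    have h1 : (fun y => ν y (F y)) =ᶠ[nhds x] fun _ => 1 := by
      filter_upwards [hxU] with y hy using h.self_eq y hy
    have h2 := h1.fderiv_eq (𝕜 := ℝ)
    rw [(hdν.hasFDerivAt.clm_apply hdF.hasFDerivAt).fderiv] at h2
    simpa [h.tangent_eq x hx] using congrArg (fun l : E →L[ℝ] ℝ => l a) h2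
  have e3 : ∀ a b, fderiv ℝ ν x a (fderiv ℝ F x b) = - ν x (fderiv ℝ (fderiv ℝ F) x a b) := by
    intro a b
    have h1 : (fun y => ν y (fderiv ℝ F y b)) =ᶠ[nhds x] fun _ => 0 := by
      filter_upwards [hxU] with y hy using h.tangent_eq y hy b
    have h2 := h1.fderiv_eq (𝕜 := ℝ)
    rw [(hdν.hasFDerivAt.clm_apply (hddF.hasFDerivAt.clm_apply
      (hasFDerivAt_const b x))).fderiv] at h2
    have h3 := congrArg (fun l : E →L[ℝ] ℝ => l a) h2
    simp at h3
    linarith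
  have e4 : ∀ b, fderiv ℝ (fderiv ℝ F) x b (Z x) =
      - Jt n (fderiv ℝ F x b) - fderiv ℝ F x (fderiv ℝ Z x b) := by
    intro b
    have h1 : (fun y => fderiv ℝ F y (Z y)) =ᶠ[nhds x] fun y => - JtL n (F y) := by
      filter_upwards [hxU] with y hy using h.field_eq y hy
    have h2 := h1.fderiv_eq (𝕜 := ℝ)
    have h0 : HasFDerivAt (fun y => - JtL n (F y)) _ x :=
      ((JtL n).hasFDerivAt.comp x hdF.hasFDerivAt).neg
    rw [(hddF.hasFDerivAt.clm_apply hdZ.hasFDerivAt).fderiv, h0.fderiv] at h2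
    have h3 := congrArg (fun l : E →L[ℝ] RSpace n => l b) h2
    simp only [add_apply, ContinuousLinearMap.comp_apply, ContinuousLinearMap.flip_apply,
      neg_apply, JtL_apply] at h3
    rw [← h3]; abel
  set s := ν x (Jt n (fderiv ℝ F x b)) with hs
  obtain ⟨w, hw⟩ := h.exists_of_eq_zero x hx (Jt n (fderiv ℝ F x b) - s • F x) (by
    rw [map_sub, map_smul, h.self_eq x hx, ← hs]; simp)
  have hw' : Jt n (fderiv ℝ F x b) = fderiv ℝ F x w + s • F x := by rw [hw]; abel
  -- Split J F_*b = F_*w + sF. The F-part is killed by D_Zν. By `e3` and `e4` the rest is ν(J F_*w),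
  -- and J F_*w = F_*b - sJF is tangent.
  have e5 : fderiv ℝ ν x (Z x) (Jt n (fderiv ℝ F x b)) = 0 := by
    have h5 : ν x (Jt n (fderiv ℝ F x w)) = 0 := by
      have h6 : Jt n (F x) = fderiv ℝ F x (- Z x) := by rw [map_neg, h.field_eq x hx, neg_neg]
      rw [hw, map_sub, Jt_Jt, map_smul, h6, ← map_smul, ← map_sub, h.tangent_eq x hx]
    rw [hw', map_add, map_smul, e2, e3, hsymm, e4, map_sub, map_neg, h5, h.tangent_eq x hx]
    simp
  rw [e1, e1, e5, hsymm b, h.field_eq x hx, map_neg, Jt_Jt, map_neg, e2, neg_zero]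

/-- This is dη = 0. By `fderiv_etaForm_field` only arguments in ker η matter; these extend to the
sections a - η(a)Z of 𝒟, and η of their bracket at x is -dη(a, b). -/
theorem fderiv_etaForm_symm (h : IsConormalOn F ν Z U) (hU : IsOpen U)
    (hinv : IsInvolutiveOn F U) (hx : x ∈ U) (a b : E) :
    fderiv ℝ (etaForm F ν) x a b = fderiv ℝ (etaForm F ν) x b a := by
  have hxU := hU.mem_nhds hx
  have hη := h.contDiffOn_etaForm hU
  have hdη : DifferentiableAt ℝ (etaForm F ν) x := (hη.contDiffAt hxU).differentiableAt (by simp)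
  have hdZ : DifferentiableAt ℝ Z x :=
    (h.smooth_field.contDiffAt hxU).differentiableAt (by simp)
  have hZ := h.fderiv_etaForm_field hU hx
  have key : ∀ a b, etaForm F ν x a = 0 → etaForm F ν x b = 0 →
      fderiv ℝ (etaForm F ν) x a b = fderiv ℝ (etaForm F ν) x b a := by
    intro a b ha hb
    let X : E → E → E := fun a y => a - etaForm F ν y a • Z y
    have hX : ∀ a, ContDiffOn ℝ ∞ (X a) U := fun a =>
      contDiffOn_const.sub ((hη.clm_apply contDiffOn_const).smul h.smooth_field)
    have hXD : ∀ a, ∀ y ∈ U, X a y ∈ distr F y := fun a y hy => by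
      rw [h.mem_distr_iff hy, map_sub, map_smul, h.etaForm_field hy]; simp
    have hdX : ∀ a, etaForm F ν x a = 0 → ∀ v, fderiv ℝ (X a) x v =
        - (fderiv ℝ (etaForm F ν) x v a • Z x) := by
      intro a ha v
      have h1 : HasFDerivAt (X a) _ x := ((hasFDerivAt_const a x).sub
        ((hdη.hasFDerivAt.clm_apply (hasFDerivAt_const a x)).smul hdZ.hasFDerivAt))
      rw [h1.fderiv]
      simp [ha]
    have h1 := hinv (X a) (X b) (hX a) (hX b) (hXD a) (hXD b) x hx
    have hXx : ∀ a, etaForm F ν x a = 0 → X a x = a := fun a ha => by simp [X, ha]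
    rw [h.mem_distr_iff hx, VectorField.lieBracket, hXx a ha, hXx b hb, hdX a ha, hdX b hb,
      map_sub, map_neg, map_neg, map_smul, map_smul, h.etaForm_field hx] at h1
    simp only [smul_eq_mul, mul_one] at h1
    linarith
  have hdec : ∀ a, ∃ a' s, a = a' + s • Z x ∧ etaForm F ν x a' = 0 := fun a =>
    ⟨a - etaForm F ν x a • Z x, etaForm F ν x a, by abel, by
      rw [map_sub, map_smul, h.etaForm_field hx]; simp⟩
  obtain ⟨a', s, rfl, ha'⟩ := hdec a
  obtain ⟨b', t, rfl, hb'⟩ := hdec b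
  simp only [map_add, map_smul, add_apply, smul_apply, key a' b' ha' hb', hZ,
    smul_eq_mul]
  ring

end IsConormalOn

end CentroAffine

/-! ### Adapted coordinates in which F = R_z g -/

section AdaptedChart

variable {E B : Type*} [NormedAddCommGroup E] [NormedSpace ℝ E] [FiniteDimensional ℝ E]
  [NormedAddCommGroup B] [NormedSpace ℝ B] {n : ℕ}
  {F : E → RSpace n} {U : Set E} {ν : E → RSpace n →L[ℝ] ℝ} {Z : E → E} {p : E}

/-- A linear map with one-dimensional kernel can be completed by one functional to an
isomorphism after composition with a projection. -/
theorem exists_projection {W : Type*} [NormedAddCommGroup W] [NormedSpace ℝ W]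
    [FiniteDimensional ℝ W] [FiniteDimensional ℝ B] (hE : Module.finrank ℝ E = Module.finrank ℝ B + 1)
    (L : E →L[ℝ] W) (η : E →L[ℝ] ℝ) {v : E} (hv : η v = 1) (hLv : L v = 0)
    (hL : ∀ u, L u = 0 → u = η u • v) :
    ∃ A : W →L[ℝ] B, ∃ e : E ≃L[ℝ] B × ℝ, (e : E →L[ℝ] B × ℝ) = (A.comp L).prod η := by
  have hv0 : v ≠ 0 := by rintro rfl; simp at hv
  have hker : LinearMap.ker (L : E →ₗ[ℝ] W) = Submodule.span ℝ {v} := by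
    ext u
    rw [LinearMap.mem_ker, Submodule.mem_span_singleton, ContinuousLinearMap.coe_coe]
    constructor
    · exact fun hu => ⟨η u, (hL u hu).symm⟩
    · rintro ⟨s, rfl⟩
      rw [map_smul, hLv, smul_zero]
  have hrank : Module.finrank ℝ (LinearMap.range (L : E →ₗ[ℝ] W)) = Module.finrank ℝ B := by
    have h := LinearMap.finrank_range_add_finrank_ker (L : E →ₗ[ℝ] W)
    rw [hker, finrank_span_singleton hv0] at h
    omega
  -- `A` extends an isomorphism from the range of L onto B, so ker(A ∘ L) = ker L is the line
  -- through v, which η detects.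
  obtain ⟨A, hA⟩ := LinearMap.exists_extend
    (LinearEquiv.ofFinrankEq _ _ hrank).toLinearMap
  have hA' : ∀ w : LinearMap.range (L : E →ₗ[ℝ] W),
      A w = LinearEquiv.ofFinrankEq _ _ hrank w := fun w => LinearMap.congr_fun hA w
  let A' : W →L[ℝ] B := LinearMap.toContinuousLinearMap A
  have hinj : Function.Injective ((A'.comp L).prod η : E →ₗ[ℝ] B × ℝ) := by
    rw [← LinearMap.ker_eq_bot, LinearMap.ker_eq_bot']
    intro u hu
    have h1 : A (L u) = 0 := congrArg Prod.fst hu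
    have h2 : η u = 0 := congrArg Prod.snd hu
    have h3 := hA' ⟨L u, u, rfl⟩
    rw [h1] at h3
    have h4 := (LinearEquiv.map_eq_zero_iff _).1 h3.symm
    have h5 : L u = 0 := congrArg Subtype.val h4
    rw [hL u h5, h2, zero_smul]
  have hdim : Module.finrank ℝ E = Module.finrank ℝ (B × ℝ) := by
    rw [Module.finrank_prod, Module.finrank_self, hE]
  refine ⟨A', (LinearMap.linearEquivOfInjective _ hinj hdim).toContinuousLinearEquiv, ?_⟩
  ext u <;> rfl

/-- Inverse function theorem on a product neighbourhood. -/
theorem exists_chart_of_contDiffOn {D : Set E} (hD : IsOpen D) {Φ : E → B × ℝ}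
    (hΦ : ContDiffOn ℝ ∞ Φ D) (hp : p ∈ D) {e : E ≃L[ℝ] B × ℝ}
    (he : HasFDerivAt Φ (e : E →L[ℝ] B × ℝ) p) :
    ∃ (ψ : OpenPartialHomeomorph E (B × ℝ)) (r : ℝ), 0 < r ∧ p ∈ ψ.source ∧ ψ.source ⊆ D ∧
      (∀ y, ψ y = Φ y) ∧
      ψ.target = Metric.ball (Φ p).1 r ×ˢ Set.Ioo ((Φ p).2 - r) ((Φ p).2 + r) ∧
      ContDiffOn ℝ ∞ ψ.symm ψ.target ∧
      ∀ q ∈ ψ.target, ∃ e : E ≃L[ℝ] B × ℝ,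
        HasFDerivAt Φ (e : E →L[ℝ] B × ℝ) (ψ.symm q) ∧
        HasFDerivAt ψ.symm (e.symm : B × ℝ →L[ℝ] E) q := by
  have hE : CompleteSpace E := FiniteDimensional.complete ℝ E
  have hΦp : ContDiffAt ℝ ∞ Φ p := hΦ.contDiffAt (hD.mem_nhds hp)
  let ψ₁ := hΦp.toOpenPartialHomeomorph Φ he (by simp)
  -- Restricting to the open set where the derivative is invertible makes the inverse smooth on its
  -- whole domain, not merely at Φ(p).
  let S : Set E := D ∩ fderiv ℝ Φ ⁻¹' Set.range ((↑) : (E ≃L[ℝ] B × ℝ) → E →L[ℝ] B × ℝ)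
  have hS : IsOpen S := (hΦ.continuousOn_fderiv_of_isOpen hD (by simp)).isOpen_inter_preimage hD
    ContinuousLinearEquiv.isOpen
  have hpS : p ∈ S := ⟨hp, e, he.fderiv.symm⟩
  let ψ₂ := ψ₁.restrOpen S hS
  have hp₂ : p ∈ ψ₂.source := ⟨hΦp.mem_toOpenPartialHomeomorph_source he (by simp), hpS⟩
  have hq₂ : Φ p ∈ ψ₂.target := ψ₂.map_source hp₂
  obtain ⟨r, hr, hball⟩ := Metric.isOpen_iff.1 ψ₂.open_target (Φ p) hq₂
  -- Balls of the maximum norm on B × ℝ are products, which gives the target the shape V × I.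
  have hprod : Metric.ball (Φ p).1 r ×ˢ Set.Ioo ((Φ p).2 - r) ((Φ p).2 + r) =
      Metric.ball (Φ p) r := by
    rw [← Real.ball_eq_Ioo, ball_prod_same]
  let ψ := (ψ₂.symm.restrOpen (Metric.ball (Φ p) r) Metric.isOpen_ball).symm
  have hψt : ψ.target = Metric.ball (Φ p) r := by
    change ψ₂.target ∩ Metric.ball (Φ p) r = _
    exact Set.inter_eq_right.2 hball
  have hψS : ∀ q ∈ ψ.target, ψ.symm q ∈ S := fun q hq =>
    (ψ₂.map_target (hball (hψt ▸ hq))).2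
  have hsrc : ψ.source ⊆ S := fun y hy => by
    have := hψS _ (ψ.map_source hy)
    rwa [ψ.left_inv hy] at this
  have hder : ∀ q ∈ ψ.target, ∃ e : E ≃L[ℝ] B × ℝ,
      HasFDerivAt Φ (e : E →L[ℝ] B × ℝ) (ψ.symm q) := by
    intro q hq
    obtain ⟨hqD, e, hqe⟩ := hψS q hq
    refine ⟨e, ?_⟩
    rw [hqe]
    exact ((hΦ.contDiffAt (hD.mem_nhds hqD)).differentiableAt (by simp)).hasFDerivAt
  have hψp : p ∈ ψ.source := by
    have h1 : ψ.symm (Φ p) = p := ψ₂.left_inv hp₂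
    have h2 : Φ p ∈ ψ.target := by rw [hψt]; exact Metric.mem_ball_self hr
    rw [← h1]
    exact ψ.map_target h2
  refine ⟨ψ, r, hr, hψp, fun y hy => (hsrc hy).1, fun y => rfl, by rw [hψt, hprod], ?_, ?_⟩
  · intro q hq
    obtain ⟨e, he⟩ := hder q hq
    exact (ψ.contDiffAt_symm hq he
      (hΦ.contDiffAt (hD.mem_nhds (hψS q hq).1))).contDiffWithinAt
  · intro q hq
    obtain ⟨e, he⟩ := hder q hq
    exact ⟨e, he, ψ.hasFDerivAt_symm hq he⟩

/-- On a ball the closed form η has a primitive ζ. Undoing the rotation, G = R_{-ζ} F satisfies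
dG(u) = R_{-ζ} F_*(u - η(u)Z), so G is constant along Z and of rank dim E - 1. Functions of G
together with ζ are the coordinates, and g is G on a slice. -/
theorem IsConormalOn.exists_adapted_chart [FiniteDimensional ℝ B]
    (hE : Module.finrank ℝ E = Module.finrank ℝ B + 1)
    (h : IsConormalOn F ν Z U) (hU : IsOpen U) (hinv : IsInvolutiveOn F U) (hp : p ∈ U) :
    ∃ (ψ : OpenPartialHomeomorph E (B × ℝ)) (V : Set B) (a b : ℝ) (g : B → RSpace n),
      p ∈ ψ.source ∧ ψ.source ⊆ U ∧ ψ.target = V ×ˢ Set.Ioo a b ∧ a < b ∧ IsOpen V ∧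
      IsConnected V ∧ ContDiffOn ℝ ∞ ψ ψ.source ∧ ContDiffOn ℝ ∞ ψ.symm ψ.target ∧
      (∀ q ∈ ψ.target, Function.Bijective (fderiv ℝ ψ.symm q)) ∧ ContDiffOn ℝ ∞ g V ∧
      (∀ q ∈ ψ.target, F (ψ.symm q) = hyperMap g q) ∧
      ∀ x ∈ V, ∀ w ∈ tangent g x, Jt n w ∈ tangent g x := by
  obtain ⟨ρ, hρ, hball⟩ := Metric.isOpen_iff.1 hU p hp
  have hη := (h.contDiffOn_etaForm hU).mono hball
  obtain ⟨ζ, hζ⟩ := (convex_ball p ρ).exists_forall_hasFDerivAt_of_fderiv_symmetric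
    Metric.isOpen_ball (hη.differentiableOn (by simp))
    fun y hy => h.fderiv_etaForm_symm hU hinv (hball hy)
  have hζs : ContDiffOn ℝ ∞ ζ (Metric.ball p ρ) := by
    rw [contDiffOn_infty_iff_fderiv_of_isOpen Metric.isOpen_ball]
    exact ⟨fun y hy => (hζ y hy).differentiableAt.differentiableWithinAt,
      hη.congr fun y hy => (hζ y hy).fderiv⟩
  have hFs := h.smooth.mono hball
  let G : E → RSpace n := fun y => hyperMap id (F y, - ζ y)
  have hGs : ContDiffOn ℝ ∞ G (Metric.ball p ρ) :=
    (contDiffOn_hyperMap (contDiffOn_id (s := Set.univ)) Set.univ).comp (hFs.prodMk hζs.neg)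
      fun _ _ => ⟨trivial, trivial⟩
  have hGd : ∀ y ∈ Metric.ball p ρ, ∀ u, fderiv ℝ G y u =
      hyperRot n (- ζ y) (fderiv ℝ F y (u - etaForm F ν y u • Z y)) := by
    intro y hy u
    have hdF : DifferentiableAt ℝ F y :=
      (hFs.contDiffAt (Metric.isOpen_ball.mem_nhds hy)).differentiableAt (by simp)
    have h0 : HasFDerivAt (fun y => (F y, - ζ y)) _ y := hdF.hasFDerivAt.prodMk (hζ y hy).neg
    have h1 : HasFDerivAt G _ y := HasFDerivAt.comp (g := hyperMap id) y
      (hasFDerivAt_hyperMap (g := id) differentiableAt_id (- ζ y)) h0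
    rw [h1.fderiv, map_sub, map_smul, h.field_eq y (hball hy)]
    simp
  have hGZ : ∀ y ∈ Metric.ball p ρ, fderiv ℝ G y (Z y) = 0 := by
    intro y hy
    rw [hGd y hy, h.etaForm_field (hball hy)]; simp
  have hpb : p ∈ Metric.ball p ρ := Metric.mem_ball_self hρ
  -- G takes values in ℝ^{2n+2}; `A` selects dim B linear functions of G that, with ζ, are
  -- independent at p.
  obtain ⟨A, e, he⟩ := exists_projection (B := B) hE (fderiv ℝ G p) (etaForm F ν p)
    (h.etaForm_field hp) (hGZ p hpb) (fun u hu => by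
      rw [hGd p hpb] at hu
      have h1 := (hyperRot_bijective n _).1 (hu.trans (map_zero _).symm)
      have h2 := h.injective p hp (h1.trans (map_zero _).symm)
      exact sub_eq_zero.1 h2)
  let Φ : E → B × ℝ := fun y => (A (G y), ζ y)
  have hΦs : ContDiffOn ℝ ∞ Φ (Metric.ball p ρ) := (A.contDiff.comp_contDiffOn hGs).prodMk hζs
  have hΦd : ∀ y ∈ Metric.ball p ρ,
      HasFDerivAt Φ ((A.comp (fderiv ℝ G y)).prod (etaForm F ν y)) y := fun y hy =>
    (A.hasFDerivAt.comp y ((hGs.contDiffAt (Metric.isOpen_ball.mem_nhds hy)).differentiableAt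
      (by simp)).hasFDerivAt).prodMk (hζ y hy)
  obtain ⟨ψ, r, hr, hpψ, hψb, hψΦ, hψt, hψs, hψd⟩ :=
    exists_chart_of_contDiffOn Metric.isOpen_ball hΦs hpb (e := e) (by rw [he]; exact hΦd p hpb)
  set V := Metric.ball (Φ p).1 r with hV
  set z₀ := (Φ p).2 with hz₀
  have hz₀I : z₀ ∈ Set.Ioo (z₀ - r) (z₀ + r) := ⟨by linarith, by linarith⟩
  have hmem : ∀ q ∈ ψ.target, ψ.symm q ∈ Metric.ball p ρ := fun q hq => hψb (ψ.map_target hq)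
  have hΦψ : ∀ q ∈ ψ.target, Φ (ψ.symm q) = q := fun q hq => by rw [← hψΦ, ψ.right_inv hq]
  have hder : ∀ q ∈ ψ.target, ∃ e : E ≃L[ℝ] B × ℝ, HasFDerivAt ψ.symm (e.symm : B × ℝ →L[ℝ] E) q ∧
      ∀ u, e u = (A (fderiv ℝ G (ψ.symm q) u), etaForm F ν (ψ.symm q) u) := by
    intro q hq
    obtain ⟨e, he1, he2⟩ := hψd q hq
    refine ⟨e, he2, fun u => ?_⟩
    have := he1.unique (hΦd _ (hmem q hq))
    exact congrArg (fun l : E →L[ℝ] B × ℝ => l u) this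
  let g : B → RSpace n := fun x => G (ψ.symm (x, z₀))
  have hVt : ∀ x ∈ V, (x, z₀) ∈ ψ.target := fun x hx => by rw [hψt]; exact ⟨hx, hz₀I⟩
  have hgs : ContDiffOn ℝ ∞ g V :=
    (hGs.comp hψs hmem).comp (contDiff_id.prodMk contDiff_const).contDiffOn hVt
  -- The coordinate field ∂_z is Z, because dΦ(Z) = (A(dG Z), η(Z)) = (0, 1); and dG(Z) = 0.
  have hconst : ∀ q ∈ ψ.target, G (ψ.symm q) = g q.1 := by
    rintro ⟨x, z⟩ hq
    have hq' := hq
    rw [hψt] at hq'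
    have hD : ∀ z ∈ Set.Ioo (z₀ - r) (z₀ + r), HasDerivAt (fun z => G (ψ.symm (x, z))) 0 z := by
      intro z hz
      have hqz : (x, z) ∈ ψ.target := by rw [hψt]; exact ⟨hq'.1, hz⟩
      obtain ⟨e, he1, he2⟩ := hder _ hqz
      have hG1 : HasFDerivAt G (fderiv ℝ G (ψ.symm (x, z))) (ψ.symm (x, z)) :=
        ((hGs.contDiffAt (Metric.isOpen_ball.mem_nhds (hmem _ hqz))).differentiableAt
          (by simp)).hasFDerivAt
      have h2 : HasDerivAt (fun z : ℝ => (x, z)) ((0 : B), (1 : ℝ)) z :=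
        (hasDerivAt_const z x).prodMk (hasDerivAt_id z)
      have h3 := (hG1.comp (x, z) he1).comp_hasDerivAt z h2
      have h4 : e.symm ((0 : B), (1 : ℝ)) = Z (ψ.symm (x, z)) := by
        rw [ContinuousLinearEquiv.symm_apply_eq, he2, hGZ _ (hmem _ hqz),
          h.etaForm_field (hball (hmem _ hqz)), map_zero]
      have h5 : (fderiv ℝ G (ψ.symm (x, z)) ∘L (e.symm : B × ℝ →L[ℝ] E)) ((0 : B), (1 : ℝ)) = 0 := by
        rw [ContinuousLinearMap.comp_apply, ContinuousLinearEquiv.coe_coe, h4, hGZ _ (hmem _ hqz)]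
      rw [h5] at h3
      exact h3
    exact isOpen_Ioo.is_const_of_deriv_eq_zero (isPreconnected_Ioo)
      (fun z hz => (hD z hz).differentiableAt.differentiableWithinAt)
      (fun z hz => (hD z hz).deriv) hq'.2 hz₀I
  have hFg : ∀ q ∈ ψ.target, F (ψ.symm q) = hyperMap g q := by
    intro q hq
    have h1 : ζ (ψ.symm q) = q.2 := congrArg Prod.snd (hΦψ q hq)
    rw [hyperMap_eq, ← hconst q hq]
    change _ = hyperRot n q.2 (hyperRot n (- ζ (ψ.symm q)) (F (ψ.symm q)))
    rw [h1, hyperRot_hyperRot_neg]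
  refine ⟨ψ, V, z₀ - r, z₀ + r, g, hpψ, hψb.trans hball, hψt, by linarith, Metric.isOpen_ball,
    Metric.isConnected_ball hr, ?_, hψs, ?_, hgs, hFg, ?_⟩
  · exact (hΦs.mono hψb).congr fun y _ => hψΦ y
  · intro q hq
    obtain ⟨e, he1, -⟩ := hder q hq
    rw [he1.fderiv]
    exact e.symm.bijective
  · rintro x hx _ ⟨u, rfl⟩
    have hq := hVt x hx
    have hy := hball (hmem _ hq)
    obtain ⟨e, he1, he2⟩ := hder _ hq
    have hdg : DifferentiableAt ℝ g x :=
      (hgs.contDiffAt (Metric.isOpen_ball.mem_nhds hx)).differentiableAt (by simp)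
    have hdF : DifferentiableAt ℝ F (ψ.symm (x, z₀)) :=
      (h.smooth.contDiffAt (hU.mem_nhds hy)).differentiableAt (by simp)
    have hFψ : ∀ v : B × ℝ, fderiv ℝ F (ψ.symm (x, z₀)) (e.symm v) =
        hyperRot n z₀ (fderiv ℝ g x v.1 - v.2 • Jt n (g x)) := by
      intro v
      rw [← fderiv_hyperMap hdg z₀ v]
      have h1 : hyperMap g =ᶠ[nhds (x, z₀)] fun q => F (ψ.symm q) := by
        filter_upwards [ψ.open_target.mem_nhds hq] with q hq using (hFg q hq).symm
      have h2 : HasFDerivAt (fun q => F (ψ.symm q)) _ (x, z₀) := hdF.hasFDerivAt.comp _ he1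
      rw [h1.fderiv_eq, h2.fderiv]
      rfl
    -- J-invariance of g_* T: the slice directions (u, 0) are exactly those in ker η = 𝒟, which J
    -- preserves, and R_z commutes with J and so can be cancelled.
    have hu : etaForm F ν (ψ.symm (x, z₀)) (e.symm (u, 0)) = 0 := by
      have h1 := he2 (e.symm (u, 0))
      rw [e.apply_symm_apply] at h1
      exact (congrArg Prod.snd h1).symm
    obtain ⟨w, hw1, hw2⟩ := h.exists_Jt_eq hy hu
    have hw3 : w = e.symm ((e w).1, 0) := by
      rw [ContinuousLinearEquiv.eq_symm_apply]
      refine Prod.ext rfl ?_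
      rw [he2 w, hw2]
    rw [hw3, hFψ, hFψ, Jt_hyperRot] at hw1
    have h5 := (hyperRot_bijective n z₀).1 hw1
    simp only [zero_smul, sub_zero] at h5
    exact ⟨(e w).1, h5⟩

end AdaptedChart

/-! ### Affine hyperspheres in a chart -/

section Hypersphere

variable {E : Type*} [NormedAddCommGroup E] [NormedSpace ℝ E] [FiniteDimensional ℝ E] {n : ℕ}
  {F C : E → RSpace n} {U : Set E} {lam : ℝ} {x : E}

/-- If λ = 0, then DC = 0. Differentiating F_*Z = JC shows that D_v F_*Z is tangent for constant
extension of Z's value, that is h(Z, v) = 0 for all v. Nondegeneracy gives Z = 0, hence C = 0,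
against transversality. -/
theorem IsAffineHypersphereOn.lam_ne_zero (hE : Module.finrank ℝ E = 2 * n + 1) (hU : IsOpen U)
    (h : IsAffineHypersphereOn F C lam U) (hJ : IsJTangentOn F C U) (hx : x ∈ U) : lam ≠ 0 := by
  rintro rfl
  have hxU := hU.mem_nhds hx
  have hb := h.blaschke.transversal
  have hF := h.blaschke.smooth
  have hC := h.blaschke.smooth_field
  obtain ⟨Q, hQ, hQi⟩ := exists_smooth_frame_inverse hU hF hC hb
  let Z : E → E := fun y => (Q y (JtL n (C y))).1
  have hZs : ContDiffOn ℝ ∞ Z U :=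
    (hQ.clm_apply ((JtL n).contDiff.comp_contDiffOn hC)).fst
  have hZ : ∀ y ∈ U, fderiv ℝ F y (Z y) = JtL n (C y) := by
    intro y hy
    obtain ⟨u, hu⟩ := hJ y hy
    rw [ContinuousLinearMap.coe_coe] at hu
    have h1 := hQi y hy u 0
    rw [zero_smul, add_zero, hu] at h1
    change fderiv ℝ F y (Q y (Jt n (C y))).1 = _
    rw [h1, hu, JtL_apply]
  have hdC : DifferentiableAt ℝ C x := (hC.contDiffAt hxU).differentiableAt (by simp)
  have hdZ : DifferentiableAt ℝ Z x := (hZs.contDiffAt hxU).differentiableAt (by simp)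
  have hddF : DifferentiableAt ℝ (fderiv ℝ F) x :=
    ((hF.fderiv_of_isOpen hU (m := ∞) le_rfl).contDiffAt hxU).differentiableAt (by simp)
  have hsymm : ∀ a b, fderiv ℝ (fderiv ℝ F) x a b = fderiv ℝ (fderiv ℝ F) x b a := fun a b =>
    ((hF.contDiffAt hxU).isSymmSndFDerivAt (by simp; norm_cast)) a b
  have hform : ∀ v, secondForm F C x (Z x) v = 0 := by
    intro v
    have h1 : (fun y => fderiv ℝ F y (Z y)) =ᶠ[nhds x] fun y => JtL n (C y) := by
      filter_upwards [hxU] with y hy using hZ y hy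
    have h2 := h1.fderiv_eq (𝕜 := ℝ)
    have h0 : HasFDerivAt (fun y => JtL n (C y)) _ x := (JtL n).hasFDerivAt.comp x hdC.hasFDerivAt
    rw [(hddF.hasFDerivAt.clm_apply hdZ.hasFDerivAt).fderiv, h0.fderiv] at h2
    have h3 := congrArg (fun l : E →L[ℝ] RSpace n => l v) h2
    simp only [add_apply, ContinuousLinearMap.comp_apply, ContinuousLinearMap.flip_apply,
      h.fderiv_field hE hU hx, zero_smul, neg_zero, map_zero] at h3
    have h4 : fderiv ℝ (fderiv ℝ F) x (Z x) v = fderiv ℝ F x (- fderiv ℝ Z x v) := by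
      rw [hsymm, map_neg]
      exact eq_neg_of_add_eq_zero_right h3
    rw [secondForm, h4, transPart_fderiv (hb x hx)]
  have h1 := h.blaschke.nondegenerate x hx _ hform
  have h2 := hZ x hx
  rw [h1, map_zero] at h2
  have h3 : C x = 0 := by rw [← Jt_Jt (C x), ← JtL_apply (C x), ← h2, map_zero]
  have h4 : frame F C x (0, 1) = frame F C x (0, 0) := by
    rw [frame_apply, frame_apply, h3]; simp
  exact one_ne_zero (congrArg Prod.snd ((hb x hx).1 h4))

theorem IsAffineHypersphereOn.hasFDerivAt_add_smul (hE : Module.finrank ℝ E = 2 * n + 1)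
    (hU : IsOpen U) (h : IsAffineHypersphereOn F C lam U) (hx : x ∈ U) :
    HasFDerivAt (fun y => C y + lam • F y) (0 : E →L[ℝ] RSpace n) x := by
  have hxU := hU.mem_nhds hx
  have hdC : DifferentiableAt ℝ C x :=
    (h.blaschke.smooth_field.contDiffAt hxU).differentiableAt (by simp)
  have hdF : DifferentiableAt ℝ F x :=
    (h.blaschke.smooth.contDiffAt hxU).differentiableAt (by simp)
  refine (hdC.hasFDerivAt.add (hdF.hasFDerivAt.const_smul lam)).congr_fderiv ?_
  refine ContinuousLinearMap.ext fun u => ?_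
  rw [add_apply, h.fderiv_field hE hU hx, smul_apply, neg_add_cancel]
  rfl

theorem IsAffineHypersphereOn.exists_hyper_chart {B : Type*} [NormedAddCommGroup B]
    [NormedSpace ℝ B] [FiniteDimensional ℝ B] (hB : Module.finrank ℝ B = 2 * n)
    (hE : Module.finrank ℝ E = 2 * n + 1) (hU : IsOpen U)
    (h : IsAffineHypersphereOn F C lam U) (hJ : IsJTangentOn F C U) (hinv : IsInvolutiveOn F U)
    {c : RSpace n} (hc : ∀ y ∈ U, C y = - (lam • (F y - c))) (hx : x ∈ U) :
    ∃ (ψ : OpenPartialHomeomorph E (B × ℝ)) (V : Set B) (a b : ℝ) (g : B → RSpace n),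
      x ∈ ψ.source ∧ ψ.source ⊆ U ∧ ψ.target = V ×ˢ Set.Ioo a b ∧ IsOpen V ∧
      IsConnected V ∧ ContDiffOn ℝ ∞ ψ ψ.source ∧ ContDiffOn ℝ ∞ ψ.symm ψ.target ∧
      IsCenteredProperParaHypersphereOn g V ∧
      ∀ q ∈ ψ.target, F (ψ.symm q) = c + hyperMap g q := by
  have hl : lam ≠ 0 := h.lam_ne_zero hE hU hJ hx
  have hb := h.blaschke.transversal
  have hF := h.blaschke.smooth
  let F₁ : E → RSpace n := fun y => F y - c
  have hdF₁ : fderiv ℝ F₁ = fderiv ℝ F := by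
    funext y
    exact fderiv_sub_const c
  have htan : tangent F₁ = tangent F := by funext y; simp only [tangent, hdF₁]
  have hdistr : distr F₁ = distr F := by funext y; simp only [distr, htan, hdF₁]
  have hF₁ : ContDiffOn ℝ ∞ F₁ U := hF.sub contDiffOn_const
  have hb₁ : ∀ y ∈ U, Function.Bijective (frame F₁ F₁ y) := by
    intro y hy
    -- As C = -λF₁, the frames (F_*, C) and (F₁_*, F₁) differ by the factor -λ ≠ 0 in the
    -- transversal coordinate.
    have h1 : ⇑(frame F C y) = frame F₁ F₁ y ∘
        ((Equiv.refl E).prodCongr (Equiv.mulLeft₀ (- lam) (neg_ne_zero.2 hl))) := by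
      funext p
      obtain ⟨u, t⟩ := p
      rw [frame_apply, Function.comp_apply, Equiv.prodCongr_apply, Prod.map_apply, frame_apply,
        hdF₁, hc y hy]
      change fderiv ℝ F y u + t • -(lam • (F y - c)) = fderiv ℝ F y u + (- lam * t) • (F y - c)
      module
    have h2 := hb y hy
    rwa [h1, Function.Bijective.of_comp_iff _ (Equiv.bijective _)] at h2
  have hJ₁ : ∀ y ∈ U, Jt n (F₁ y) ∈ tangent F₁ y := by
    intro y hy
    have h1 := (tangent F y).smul_mem (- lam⁻¹) (hJ y hy)
    rw [htan]
    rw [hc y hy, map_neg, map_smul, neg_smul, smul_neg, neg_neg, smul_smul, inv_mul_cancel₀ hl,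
      one_smul] at h1
    exact h1
  have hinv₁ : IsInvolutiveOn F₁ U := by
    unfold IsInvolutiveOn
    rw [hdistr]
    exact hinv
  obtain ⟨ν, Z, hν⟩ := exists_isConormalOn hU hF₁ hb₁ hJ₁
  obtain ⟨ψ, V, a, b, g, hxψ, hψU, hψt, hab, hV, hVc, hψs, hψs', hψd, hg, hFg, hJg⟩ :=
    hν.exists_adapted_chart (B := B) (by rw [hE, hB]) hU hinv₁ hx
  have hFg' : ∀ q ∈ ψ.target, F (ψ.symm q) = c + hyperMap g q := fun q hq => by
    rw [← hFg q hq]; simp [F₁]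
  refine ⟨ψ, V, a, b, g, hxψ, hψU, hψt, hV, hVc, hψs, hψs', ?_, hFg'⟩
  have hz : ∀ y ∈ V, (y, (a + b) / 2) ∈ ψ.target := fun y hy => by
    rw [hψt]; exact ⟨hy, by constructor <;> linarith⟩
  have hmem : ∀ q ∈ ψ.target, ψ.symm q ∈ U := fun q hq => hψU (ψ.map_target hq)
  have hF2 : ∀ q ∈ ψ.target, ContDiffAt ℝ 2 F (ψ.symm q) := fun q hq =>
    (hF.contDiffAt (hU.mem_nhds (hmem q hq))).of_le (by norm_cast)
  have hψ2 : ∀ q ∈ ψ.target, ContDiffAt ℝ 2 ψ.symm q := fun q hq =>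
    (hψs'.contDiffAt (ψ.open_target.mem_nhds hq)).of_le (by norm_cast)
  have hform : ∀ q ∈ ψ.target, ∀ u v, secondForm (fun q => F (ψ.symm q)) (fun q => C (ψ.symm q))
      q u v = secondForm F C (ψ.symm q) (fderiv ℝ ψ.symm q u) (fderiv ℝ ψ.symm q v) := fun q hq =>
    secondForm_pullback (hF2 q hq) (hψ2 q hq) (hψd q hq) (hb _ (hmem q hq))
  -- Any slice of the interval would serve; the midpoint is used.
  refine isCenteredProperParaHypersphereOn_of_hyper hB hV hg (F := fun q => F (ψ.symm q))
    (C := fun q => C (ψ.symm q)) hl ((a + b) / 2) ?_ ?_ ?_ ?_ ?_ hJg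
  · intro y hy
    have h1 : (fun q => F (ψ.symm q)) =ᶠ[nhds (y, (a + b) / 2)] fun q => c + hyperMap g q := by
      filter_upwards [ψ.open_target.mem_nhds (hz y hy)] with q hq using hFg' q hq
    have h2 : fderiv ℝ (fun q => c + hyperMap g q) = fderiv ℝ (hyperMap g) := by
      funext q
      exact fderiv_const_add c
    rw [← h2]
    exact h1.fderiv
  · intro y hy
    rw [hc _ (hmem _ (hz y hy)), hFg' _ (hz y hy), add_sub_cancel_left]
  · intro y hy
    exact frame_pullback_bijective ((hF2 _ (hz y hy)).differentiableAt (by norm_num))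
      ((hψ2 _ (hz y hy)).differentiableAt (by norm_num)) (hψd _ (hz y hy)) (hb _ (hmem _ (hz y hy)))
  · intro y hy p hp
    have hd := hψd _ (hz y hy)
    have h1 := h.blaschke.nondegenerate _ (hmem _ (hz y hy))
      (fderiv ℝ ψ.symm (y, (a + b) / 2) p) fun v => by
        obtain ⟨q, rfl⟩ := hd.2 v
        rw [← hform _ (hz y hy), hp]
    exact hd.1 (h1.trans (map_zero _).symm)
  · intro y hy X
    rw [inducedVol_pullback ((hF2 _ (hz y hy)).differentiableAt (by norm_num))
      ((hψ2 _ (hz y hy)).differentiableAt (by norm_num))]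
    simp only [hform _ (hz y hy)]
    exact abs_det_eq_inducedVol_sq hE (hb _ (hmem _ (hz y hy)))
      (h.blaschke.volume _ (hmem _ (hz y hy))) _

end Hypersphere

/-! ### Passage to manifolds -/

section Global

variable {n : ℕ}

/-- D(C + λf) = 0 in every chart, so C + λf is constant on the connected M, and its value is λc. -/
theorem exists_center {M : Type*} [TopologicalSpace M]
    [ChartedSpace (EuclideanSpace ℝ (Fin (2 * n + 1))) M] [ConnectedSpace M] {f C : M → RSpace n}
    {lam : ℝ} (h : ∀ p : M,
      IsAffineHypersphereOn (f ∘ (extChartAt (𝓡 (2 * n + 1)) p).symm)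
        (C ∘ (extChartAt (𝓡 (2 * n + 1)) p).symm) lam (extChartAt (𝓡 (2 * n + 1)) p).target)
    (hl : lam ≠ 0) : ∃ c, ∀ p, C p = - (lam • (f p - c)) := by
  have hloc : IsLocallyConstant fun p => C p + lam • f p := by
    rw [IsLocallyConstant.iff_eventually_eq]
    intro p
    have hU := isOpen_extChartAt_target (I := 𝓡 (2 * n + 1)) p
    obtain ⟨r, hr, hball⟩ := Metric.isOpen_iff.1 hU _ (mem_extChartAt_target p)
    have hd : ∀ y ∈ Metric.ball (extChartAt (𝓡 (2 * n + 1)) p p) r, HasFDerivAt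
        (fun y => C ((extChartAt (𝓡 (2 * n + 1)) p).symm y) +
          lam • f ((extChartAt (𝓡 (2 * n + 1)) p).symm y)) _ y := fun y hy =>
      (h p).hasFDerivAt_add_smul finrank_euclideanSpace_fin hU (hball hy)
    have hconst : ∀ y ∈ Metric.ball (extChartAt (𝓡 (2 * n + 1)) p p) r,
        C ((extChartAt (𝓡 (2 * n + 1)) p).symm y) +
          lam • f ((extChartAt (𝓡 (2 * n + 1)) p).symm y) = C p + lam • f p := by
      intro y hy
      have h1 := Metric.isOpen_ball.is_const_of_fderiv_eq_zero
        (convex_ball (extChartAt (𝓡 (2 * n + 1)) p p) r).isPreconnected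
        (fun y hy => (hd y hy).differentiableAt.differentiableWithinAt)
        (fun y hy => (hd y hy).fderiv) hy (Metric.mem_ball_self hr)
      rw [extChartAt_to_inv] at h1
      exact h1
    filter_upwards [extChartAt_source_mem_nhds (I := 𝓡 (2 * n + 1)) p,
      (continuousAt_extChartAt (I := 𝓡 (2 * n + 1)) p).eventually
        (Metric.ball_mem_nhds _ hr)] with q hq1 hq2
    have h1 := hconst _ hq2
    rwa [(extChartAt (𝓡 (2 * n + 1)) p).left_inv hq1] at h1
  obtain ⟨p₀⟩ : Nonempty M := inferInstance
  refine ⟨lam⁻¹ • (C p₀ + lam • f p₀), fun p => ?_⟩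
  rw [← hloc.apply_eq_of_preconnectedSpace p p₀, smul_sub, smul_smul, mul_inv_cancel₀ hl]
  module

theorem subsingleton_of_zero_dim {E N : Type*} [TopologicalSpace E] [Subsingleton E]
    [TopologicalSpace N] [ChartedSpace E N] [PreconnectedSpace N] : Subsingleton N := by
  have hloc : IsLocallyConstant (id : N → N) := by
    rw [IsLocallyConstant.iff_eventually_eq]
    intro p
    filter_upwards [chart_source_mem_nhds E p] with q hq
    exact (chartAt E p).injOn hq (mem_chart_source E p) (Subsingleton.elim _ _)
  exact ⟨fun p q => hloc.apply_eq_of_preconnectedSpace p q⟩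

/-- For n > 0 the normalization gives κ = 1. For n = 0 there is nothing to rescale: θ_ζ is a fixed
nonzero number and the normalization may be vacuous. But N is then a single point, so κ = θ_ζ⁻² is a
legitimate constant. -/
theorem exists_volume_constant {N : Type*} [TopologicalSpace N]
    [ChartedSpace (EuclideanSpace ℝ (Fin (2 * n))) N] [ConnectedSpace N] {g ζ : N → RSpace n}
    {a : ℝ} (ha : a ≠ 0)
    (h : ∀ p : N, IsParaHypersphereOn (g ∘ (extChartAt (𝓡 (2 * n)) p).symm)
      (ζ ∘ (extChartAt (𝓡 (2 * n)) p).symm) a (extChartAt (𝓡 (2 * n)) p).target)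
    (hζ : ∀ p, ζ p = - (a • g p)) :
    ∃ κ : ℝ, 0 < κ ∧ ∀ p : N, ∀ x ∈ (extChartAt (𝓡 (2 * n)) p).target,
      ∃ X : Fin (2 * n) → EuclideanSpace ℝ (Fin (2 * n)), LinearIndependent ℝ X ∧
        |Matrix.det (Matrix.of fun i j => pform1 (g ∘ (extChartAt (𝓡 (2 * n)) p).symm)
          (ζ ∘ (extChartAt (𝓡 (2 * n)) p).symm) x (X i) (X j))| =
        κ * pvol (g ∘ (extChartAt (𝓡 (2 * n)) p).symm)
          (ζ ∘ (extChartAt (𝓡 (2 * n)) p).symm) x X ^ 2 := by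
  have hne : ∀ p : N, ∀ x ∈ (extChartAt (𝓡 (2 * n)) p).target,
      ∀ X : Fin (2 * n) → EuclideanSpace ℝ (Fin (2 * n)), LinearIndependent ℝ X →
      pvol (g ∘ (extChartAt (𝓡 (2 * n)) p).symm)
          (ζ ∘ (extChartAt (𝓡 (2 * n)) p).symm) x X ≠ 0 := fun p x hx X hX =>
    (h p).pvol_ne_zero (isOpen_extChartAt_target p) ha (fun _ _ => hζ _) hx hX
  rcases Nat.eq_zero_or_pos n with rfl | hn
  · have hI : IsEmpty (Fin (2 * 0)) := Fin.isEmpty'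
    have hsub : Subsingleton N :=
      subsingleton_of_zero_dim (E := EuclideanSpace ℝ (Fin (2 * 0)))
    obtain ⟨p₀⟩ : Nonempty N := inferInstance
    have hX : LinearIndependent ℝ (isEmptyElim : Fin (2 * 0) → EuclideanSpace ℝ (Fin (2 * 0))) :=
      linearIndependent_empty_type
    have h0 := hne p₀ _ (mem_extChartAt_target p₀) _ hX
    refine ⟨_, inv_pos.2 (pow_pos (abs_pos.2 h0) 2), fun p x hx => ⟨_, hX, ?_⟩⟩
    obtain rfl : p = p₀ := Subsingleton.elim _ _
    obtain rfl : x = extChartAt (𝓡 (2 * 0)) p p := Subsingleton.elim _ _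
    rw [Matrix.det_isEmpty, abs_one, sq_abs, inv_mul_cancel₀ (pow_ne_zero 2 h0)]
  · exact ⟨1, one_pos, fun p x hx => (h p).normal.exists_normalized_frame
      finrank_euclideanSpace_fin hn.ne' hx (hne p x hx)⟩

theorem isJTangentAffineHypersphere_hyperMap {N : Type*} [TopologicalSpace N]
    [ChartedSpace (EuclideanSpace ℝ (Fin (2 * n))) N] [ConnectedSpace N] {g : N → RSpace n}
    (hg : IsCenteredProperParaHypersphere (𝓡 (2 * n)) g) :
    ∃ C : N × ℝ → RSpace n,
      IsJTangentAffineHypersphere ((𝓡 (2 * n)).prod 𝓘(ℝ, ℝ)) (hyperMap g) C ∧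
      HasInvolutiveDistribution ((𝓡 (2 * n)).prod 𝓘(ℝ, ℝ)) (hyperMap g) := by
  obtain ⟨a, ζ, ha, h, hζ⟩ := hg
  obtain ⟨κ, hκ, hκX⟩ := exists_volume_constant ha h hζ
  -- λ > 0 is the solution of λ^{2n+3} = κ|a|^{2n+4}, the volume balance for f.
  obtain ⟨lam, hl, hlam⟩ := exists_pos_pow_eq
    (mul_pos hκ (pow_pos (abs_pos.2 ha) (2 * n + 4))) (k := 2 * n + 3) (by omega)
  have hF : ∀ p : N × ℝ, hyperMap g ∘ (extChartAt ((𝓡 (2 * n)).prod 𝓘(ℝ, ℝ)) p).symm =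
      hyperMap (g ∘ (extChartAt (𝓡 (2 * n)) p.1).symm) := by
    intro p
    rw [extChartAt_prod]
    rfl
  have hT : ∀ p : N × ℝ, (extChartAt ((𝓡 (2 * n)).prod 𝓘(ℝ, ℝ)) p).target =
      (extChartAt (𝓡 (2 * n)) p.1).target ×ˢ (Set.univ : Set ℝ) := by
    intro p
    rw [extChartAt_prod, extChartAt_model_space_eq_id]
    rfl
  have hC : ∀ p : N × ℝ, (fun q => - (lam • hyperMap g q)) ∘
      (extChartAt ((𝓡 (2 * n)).prod 𝓘(ℝ, ℝ)) p).symm =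
      fun q => - (lam • hyperMap (g ∘ (extChartAt (𝓡 (2 * n)) p.1).symm) q) := by
    intro p
    rw [← hF p]
    rfl
  refine ⟨fun q => - (lam • hyperMap g q), ⟨lam, fun p => ?_⟩, fun p => ?_⟩
  · rw [hF, hT, hC]
    refine ⟨(h p.1).isAffineHypersphereOn_hyperMap finrank_euclideanSpace_fin
      (isOpen_extChartAt_target p.1) ha (fun _ _ => hζ _) (hκX p.1) hl hlam,
      isJTangentOn_hyperMap (fun x hx => ?_) lam⟩
    exact ((h p.1).normal.smooth.contDiffAt
      ((isOpen_extChartAt_target p.1).mem_nhds hx)).differentiableAt (by simp)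
  · rw [hF, hT]
    exact (h p.1).isInvolutiveOn_hyperMap (isOpen_extChartAt_target p.1) ha fun _ _ => hζ _

end Global

end

end ParaAffine

theorem mainTheorem1 (n : ℕ) :
    (∀ (M : Type*) [TopologicalSpace M] [ChartedSpace (EuclideanSpace ℝ (Fin (2 * n + 1))) M]
        [IsManifold (𝓡 (2 * n + 1)) ∞ M] [ConnectedSpace M] (f C : M → ParaAffine.RSpace n),
        ParaAffine.IsJTangentAffineHypersphere (𝓡 (2 * n + 1)) f C →
        ParaAffine.HasInvolutiveDistribution (𝓡 (2 * n + 1)) f →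
        ∃ (lam : ℝ) (c : ParaAffine.RSpace n), lam ≠ 0 ∧
          (∀ p, C p = - (lam • (f p - c))) ∧
          ∀ p : M, ∃ (V : Set (EuclideanSpace ℝ (Fin (2 * n)))) (a b : ℝ)
            (ψ : OpenPartialHomeomorph (EuclideanSpace ℝ (Fin (2 * n)) × ℝ) M)
            (g : EuclideanSpace ℝ (Fin (2 * n)) → ParaAffine.RSpace n),
            IsOpen V ∧ IsConnected V ∧ ψ.source = V ×ˢ Set.Ioo a b ∧ p ∈ ψ.target ∧
            ContMDiffOn 𝓘(ℝ, EuclideanSpace ℝ (Fin (2 * n)) × ℝ) (𝓡 (2 * n + 1)) ∞ ψ ψ.source ∧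
            ContMDiffOn (𝓡 (2 * n + 1)) 𝓘(ℝ, EuclideanSpace ℝ (Fin (2 * n)) × ℝ) ∞
              ψ.symm ψ.target ∧
            ParaAffine.IsCenteredProperParaHypersphereOn g V ∧
            ∀ q ∈ V ×ˢ Set.Ioo a b, f (ψ q) = c + ParaAffine.hyperMap g q) ∧
    (∀ (N : Type*) [TopologicalSpace N] [ChartedSpace (EuclideanSpace ℝ (Fin (2 * n))) N]
        [IsManifold (𝓡 (2 * n)) ∞ N] [ConnectedSpace N] (g : N → ParaAffine.RSpace n),
        ParaAffine.IsCenteredProperParaHypersphere (𝓡 (2 * n)) g →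
        ∃ C : N × ℝ → ParaAffine.RSpace n,
          ParaAffine.IsJTangentAffineHypersphere ((𝓡 (2 * n)).prod 𝓘(ℝ, ℝ))
            (ParaAffine.hyperMap g) C ∧
          ParaAffine.HasInvolutiveDistribution ((𝓡 (2 * n)).prod 𝓘(ℝ, ℝ))
            (ParaAffine.hyperMap g)) := by
  refine ⟨?_, fun N _ _ _ _ g hg => ParaAffine.isJTangentAffineHypersphere_hyperMap hg⟩
  intro M _ _ _ _ f C hf hinv
  obtain ⟨lam, h⟩ := hf
  obtain ⟨p₀⟩ : Nonempty M := inferInstance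
  have hl : lam ≠ 0 := (h p₀).1.lam_ne_zero finrank_euclideanSpace_fin
    (isOpen_extChartAt_target p₀) (h p₀).2 (mem_extChartAt_target p₀)
  obtain ⟨c, hc⟩ := ParaAffine.exists_center (fun p => (h p).1) hl
  refine ⟨lam, c, hl, hc, fun p => ?_⟩
  obtain ⟨ψ, V, a, b, g, hpψ, hψU, hψt, hV, hVc, hψs, hψs', hg, hfg⟩ :=
    (h p).1.exists_hyper_chart (B := EuclideanSpace ℝ (Fin (2 * n))) finrank_euclideanSpace_fin
      finrank_euclideanSpace_fin (isOpen_extChartAt_target p) (h p).2 (hinv p) (c := c)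
      (fun y _ => hc _) (mem_extChartAt_target p)
  let χ := chartAt (EuclideanSpace ℝ (Fin (2 * n + 1))) p
  have hχt : (extChartAt (𝓡 (2 * n + 1)) p).target = χ.target := by simp [mfld_simps, χ]
  have hψχ : ψ.source ⊆ χ.target := hχt ▸ hψU
  -- No shrinking occurs in the composition, since the source of `ψ` lies in the image of the
  -- manifold chart `χ`.
  have hsrc : (χ.trans ψ).symm.source = V ×ˢ Set.Ioo a b := by
    rw [← hψt]
    refine Set.inter_eq_left.2 fun q hq => hψχ (ψ.map_target hq)
  have hχs : ContMDiffOn (𝓡 (2 * n + 1)) (𝓡 (2 * n + 1)) ∞ χ χ.source := contMDiffOn_chart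
  have hχs' : ContMDiffOn (𝓡 (2 * n + 1)) (𝓡 (2 * n + 1)) ∞ χ.symm χ.target :=
    contMDiffOn_chart_symm
  refine ⟨V, a, b, (χ.trans ψ).symm, g, hV, hVc, hsrc, ⟨mem_chart_source _ p, hpψ⟩, ?_, ?_, hg, ?_⟩
  · exact hχs'.comp ((contMDiffOn_iff_contDiffOn.2 hψs').mono (hsrc.trans hψt.symm).subset)
      fun q hq => hψχ (ψ.map_target ((hsrc.trans hψt.symm).subset hq))
  · exact (contMDiffOn_iff_contDiffOn.2 hψs).comp (hχs.mono Set.inter_subset_left)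
      fun q hq => hq.2
  · intro q hq
    exact hfg q (hψt.symm ▸ hq)
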